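/- Let $\Delta=\{z\in\mathbb C:|z|<1\}$. A function $h$ that is holomorphic and injective on $\Delta$ is called univalent; it is called spirallike if it is univalent and there is $\mu\in\mathbb C$ with $\operatorname{Re}\mu>0$ such that $e^{-t\mu}h(z)\in h(\Delta)$ for all $z\in\Delta$ and $t\ge0$. For $\tau\in\Delta$ let $\mathrm{Spi}[\tau]$ be the set of spirallike functions $h$ with $h(\tau)=0$. A holomorphic function $f:\Delta\to\mathbb C$ is called a generator if there is a one-parameter continuous semigroup $\{F_t\}_{t\ge0}$ of holomorphic self-mappings of $\Delta$ (that is, $F_{t+s}=F_t\circ F_s$, $F_0=\mathrm{id}$, and $t\mapsto F_t(z)$ is continuous on $[0,\infty)$ for each $z\in\Delta$) with $f(z)=\lim_{t\to0^+}\frac{z-F_t(z)}{t}$ for all $z\in\Delta$. Let $\mathcal G^+[1]$ be the set of generators $f$ with angular (non-tangential) limits $\angle\lim_{z\to1}f(z)=0$ and $f'(1):=\angle\lim_{z\to1}\frac{f(z)}{z-1}\in(0,\infty)$. **Theorem 3.4.** Let $f\in\mathcal G^+[1]$ with $f'(1)=\beta$, and let $\Omega_\pm=\{\omega\in\mathbb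 C:\ |\omega\mp\beta|\le\beta,\ \omega\ne0\}$. For $\lambda\in\mathbb C$, the initial value problem $$\lambda h(z)=h'(z)f(z)\quad(z\in\Delta),\qquad h(0)=1,$$ has a univalent solution $h$ on $\Delta$ if and only if $\lambda\in\Omega_+\cup\Omega_-$. Moreover, let $\lambda\ne0$ and let $h$ be a holomorphic solution on $\Delta$ of this problem. Then $h$ has a holomorphic logarithm $\log h$ on $\Delta$ with $\log h(0)=0$, and, with $h^{\alpha}:=e^{\alpha\log h}$: * For each $\mu\in\Omega_+$ there are functions $h_\tau\in\mathrm{Spi}[\tau]$, $\tau\in\Delta$, which converge to $h^{\mu/\lambda}$ uniformly on compact subsets of $\Delta$ as $\tau\to1$ unrestrictedly in $\Delta$. In particular, if $\lambda\in\Omega_+$, there are $h_\tau\in\mathrm{Spi}[\tau]$, $\tau\in\Delta$, which converge in this sense to $h$ itself. * For each $\mu\in\Omega_-$ there are meromorphic functions $\widetilde h_\tau$ on $\Delta$, $\tau\in\Delta$, such that $\tau$ is the only pole of $\widetilde h_\tau$ in $\Delta$ and is simple, and which converge to $h^{\mu/\lambda}$ uniformly on compact subsets of $\Delta$ as $\tau\to1$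 unrestrictedly in $\Delta$. -/

import Mathlib

open Set Filter Topology

/-- The open unit disk in the complex plane. -/
def unitDisk : Set ℂ := Metric.ball 0 1

/-- A univalent function: holomorphic and injective on the unit disk. -/
def IsUnivalent (h : ℂ → ℂ) : Prop :=
  DifferentiableOn ℂ h unitDisk ∧ InjOn h unitDisk

/-- A spirallike function: univalent, and for some `μ` with `0 < re μ` the image of the disk
contains, with each of its points `h z`, the whole spiral `exp (-t μ) * h z`, `t ≥ 0`. -/
def IsSpirallike (h : ℂ → ℂ) : Prop :=
  IsUnivalent h ∧ ∃ μ : ℂ, 0 < μ.re ∧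
    ∀ z ∈ unitDisk, ∀ t : ℝ, 0 ≤ t → Complex.exp (-(t : ℂ) * μ) * h z ∈ h '' unitDisk

/-- The class `Spi[τ]`, for an interior point `τ` of the disk: the spirallike functions that
vanish at `τ`. -/
def Spi (τ : ℂ) : Set (ℂ → ℂ) := {h | IsSpirallike h ∧ h τ = 0}

/-- A one-parameter continuous semigroup of holomorphic self-mappings of the unit disk. Only the
values `F t z` with `0 ≤ t` and `z` in the disk matter. -/
structure IsHolSemigroup (F : ℝ → ℂ → ℂ) : Prop where
  mapsTo : ∀ t, 0 ≤ t → MapsTo (F t) unitDisk unitDisk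
  holomorphic : ∀ t, 0 ≤ t → DifferentiableOn ℂ (F t) unitDisk
  add : ∀ s t, 0 ≤ s → 0 ≤ t → ∀ z ∈ unitDisk, F (t + s) z = F t (F s z)
  zero : ∀ z ∈ unitDisk, F 0 z = z
  continuous : ∀ z ∈ unitDisk, ContinuousOn (fun t => F t z) (Ici 0)

/-- The class `G` of infinitesimal generators of such semigroups:
`f z = lim_{t → 0+} (z - F t z) / t` on the disk. -/
def IsGenerator (f : ℂ → ℂ) : Prop :=
  DifferentiableOn ℂ f unitDisk ∧ ∃ F : ℝ → ℂ → ℂ, IsHolSemigroup F ∧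
    ∀ z ∈ unitDisk, Tendsto (fun t : ℝ => (z - F t z) / (t : ℂ)) (𝓝[>] 0) (𝓝 (f z))

/-- `g` has the angular (non-tangential) limit `l` at the boundary point `1`: it tends to `l`
inside each nontangential region `{z | ‖z‖ < 1 ∧ ‖1 - z‖ < M * (1 - ‖z‖)}`. -/
def HasAngularLimitAtOne (g : ℂ → ℂ) (l : ℂ) : Prop :=
  ∀ M : ℝ, 1 < M → Tendsto g (𝓝[Complex.stolzSet M] 1) (𝓝 l)

/-- `f` belongs to `G⁺[1]` and its angular derivative at `1` is `β` (a positive number). -/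
structure IsGPlusOne (f : ℂ → ℂ) (β : ℝ) : Prop where
  generator : IsGenerator f
  boundary_zero : HasAngularLimitAtOne f 0
  angular_deriv : HasAngularLimitAtOne (fun z => f z / (z - 1)) (β : ℂ)
  pos : 0 < β

/-- `h` is a holomorphic solution in the disk of `lam * h = h' * f`, `h 0 = 1`. -/
structure IsSolution (f : ℂ → ℂ) (lam : ℂ) (h : ℂ → ℂ) : Prop where
  holomorphic : DifferentiableOn ℂ h unitDisk
  equation : ∀ z ∈ unitDisk, lam * h z = deriv h z * f z
  initial : h 0 = 1

/-- The set `Ω₊ = {ω ≠ 0 : |ω - β| ≤ β}`. -/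
def OmegaPlus (β : ℝ) : Set ℂ := {ω | ‖ω - (β : ℂ)‖ ≤ β ∧ ω ≠ 0}

/-- The set `Ω₋ = {ω ≠ 0 : |ω + β| ≤ β}`. -/
def OmegaMinus (β : ℝ) : Set ℂ := {ω | ‖ω + (β : ℂ)‖ ≤ β ∧ ω ≠ 0}

/-- `g` is, in the disk, the power `h ^ α` of a function `h` with `h 0 = 1`: `g = exp (α * L)`,
where `L` is the holomorphic branch of `log h` in the disk with `L 0 = 0`. -/
def IsHolPower (h : ℂ → ℂ) (α : ℂ) (g : ℂ → ℂ) : Prop :=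
  ∃ L : ℂ → ℂ, DifferentiableOn ℂ L unitDisk ∧ L 0 = 0 ∧
    (∀ z ∈ unitDisk, Complex.exp (L z) = h z) ∧
    ∀ z ∈ unitDisk, g z = Complex.exp (α * L z)

/-- `g` is meromorphic in the disk, and `τ` is its only pole there and is a simple pole. -/
def HasUniqueSimplePoleAt (g : ℂ → ℂ) (τ : ℂ) : Prop :=
  MeromorphicOn g unitDisk ∧ DifferentiableOn ℂ g (unitDisk \ {τ}) ∧
    meromorphicOrderAt g τ = -1

/-- `H τ` converges to `g`, locally uniformly in the disk, as `τ` tends to `1` unrestrictedly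
within the disk. -/
def ConvergesAsTauToOne (H : ℂ → ℂ → ℂ) (g : ℂ → ℂ) : Prop :=
  TendstoLocallyUniformlyOn H g (𝓝[unitDisk] 1) unitDisk

open scoped ComplexConjugate

/-! Let `G` be the primitive of `1 / f` with `G 0 = 0`. It is an Abel function of the semigroup, `G
(F t z) = G z - t`, and every solution of the initial value problem is `exp (lam * G)`, so
univalence is a question about the domain `G(Δ)`.

In the coordinate `w = (1 + z) / (1 - z)` the field `-f` becomes `V`, and Schwarz–Pick for the
semigroup yields Julia's inequality `Re V ≥ β Re w` (`IsGPlusOne.julia`). Hence the derivative `-1 /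
V` of `G` lies in a half-plane and `G` is injective. Its image is open, invariant under translations
to the left, and its heights fill an interval of length exactly `π / β`: Schwarz–Pick against a
half-strip gives the upper bound (`IsGPlusOne.im_sub_le`), the angular derivative gives sharpness
(`IsGPlusOne.exists_lt_im_sub`). For `lam ≠ 0`, `exp (lam * G)` is injective iff no nonzero multiple
of `2πi / lam` joins two points of the image, that is, iff `|Im (2πi / lam)| ≥ π / β`; this
describes `Ω₊ ∪ Ω₋`.

For the approximation write `f = (z - 1)(1 - z) p` with `p = q + (β / 2)(1 + z) / (1 - z)`, where
`Re q ≥ 0` by Julia. Move the zero inside: `f_τ = (z - τ)(1 - τ̄ z) p_τ` with `Re p_τ > 0`. The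
equation `f_τ'(τ) h = h' f_τ` has a solution in `Spi τ` (`exists_mem_spi`), and these solutions,
normalized at the origin, tend to `exp (μ G)` once `p_τ → p` and `f_τ'(τ) = (1 - |τ|²) p_τ(τ) → μ`
(`tendstoLocallyUniformlyOn_exp_of_hasDerivAt`). The multiplier is tuned by replacing the argument
`z` of the Cayley kernel by `s z` with `|s| ≤ 1`; this is possible because `μ ∈ Ω₊` means `Re (β /
μ) ≥ 1 / 2`. For `Ω₋`, take reciprocals of the approximants for `-μ`. -/

/-! ### Cayley transforms and the Schwarz–Pick lemma in the half-plane. -/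

/-- The open right half-plane. -/
def rightHalfPlane : Set ℂ := {w | 0 < w.re}

theorem isOpen_rightHalfPlane : IsOpen rightHalfPlane :=
  isOpen_lt continuous_const Complex.continuous_re

theorem convex_rightHalfPlane : Convex ℝ rightHalfPlane := convex_halfSpace_re_gt 0

theorem isOpen_unitDisk : IsOpen unitDisk := Metric.isOpen_ball

theorem mem_unitDisk {z : ℂ} : z ∈ unitDisk ↔ ‖z‖ < 1 := by
  simp [unitDisk]

theorem zero_mem_unitDisk : (0 : ℂ) ∈ unitDisk := by simp [mem_unitDisk]

theorem one_sub_ne_zero_of_mem_unitDisk {z : ℂ} (hz : z ∈ unitDisk) : 1 - z ≠ 0 := by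
  intro h
  rw [mem_unitDisk, ← sub_eq_zero.1 h] at hz
  simp at hz

theorem one_sub_normSq_pos {z : ℂ} (hz : z ∈ unitDisk) : 0 < 1 - Complex.normSq z := by
  rw [mem_unitDisk] at hz
  rw [Complex.normSq_eq_norm_sq]
  nlinarith [norm_nonneg z]

/-- The Cayley transform from the unit disk to the right half-plane. -/
noncomputable def cayley (z : ℂ) : ℂ := (1 + z) / (1 - z)

/-- The inverse Cayley transform, from the right half-plane to the unit disk. -/
noncomputable def cayleyInv (w : ℂ) : ℂ := (w - 1) / (w + 1)

/-- The conformal map of the unit disk onto the right half-plane with value `b` at the origin. -/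
noncomputable def diskToHalfPlane (b u : ℂ) : ℂ := (b + conj b * u) / (1 - u)

/-- The conformal map of the right half-plane onto the unit disk with `b ↦ 0`. -/
noncomputable def halfPlaneToDisk (b w : ℂ) : ℂ := (w - b) / (w + conj b)

theorem diskToHalfPlane_re (b u : ℂ) :
    (diskToHalfPlane b u).re = b.re * (1 - Complex.normSq u) / Complex.normSq (1 - u) := by
  rw [diskToHalfPlane, Complex.div_re, ← add_div]
  congr 1
  simp [Complex.normSq_apply]
  ring

theorem diskToHalfPlane_mem {b u : ℂ} (hb : b ∈ rightHalfPlane) (hu : u ∈ unitDisk) :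
    diskToHalfPlane b u ∈ rightHalfPlane := by
  change 0 < (diskToHalfPlane b u).re
  rw [diskToHalfPlane_re]
  exact div_pos (mul_pos hb (one_sub_normSq_pos hu))
    (Complex.normSq_pos.2 (one_sub_ne_zero_of_mem_unitDisk hu))

/-- Turns contraction of the pseudo-hyperbolic distance `|w - b| / |w + b̄|` into a polynomial
inequality, with the real parts entering as a product. -/
theorem normSq_add_conj (w b : ℂ) :
    ‖w + conj b‖ ^ 2 = ‖w - b‖ ^ 2 + 4 * (w.re * b.re) := by
  rw [← Complex.normSq_eq_norm_sq, ← Complex.normSq_eq_norm_sq]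
  simp [Complex.normSq_apply]
  ring

theorem add_conj_ne_zero {w b : ℂ} (hw : w ∈ rightHalfPlane) (hb : b ∈ rightHalfPlane) :
    w + conj b ≠ 0 := by
  intro h
  have := congrArg Complex.re h
  simp at this
  have h1 : 0 < w.re := hw
  have h2 : 0 < b.re := hb
  linarith

theorem halfPlaneToDisk_mem {w b : ℂ} (hw : w ∈ rightHalfPlane) (hb : b ∈ rightHalfPlane) :
    halfPlaneToDisk b w ∈ unitDisk := by
  have h1 : 0 < w.re := hw
  have h2 : 0 < b.re := hb
  rw [mem_unitDisk, halfPlaneToDisk, norm_div,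
    div_lt_one (norm_pos_iff.2 (add_conj_ne_zero hw hb))]
  refine lt_of_pow_lt_pow_left₀ 2 (norm_nonneg _) ?_
  rw [normSq_add_conj]
  nlinarith [mul_pos h1 h2]

theorem diskToHalfPlane_halfPlaneToDisk {w b : ℂ} (hw : w ∈ rightHalfPlane)
    (hb : b ∈ rightHalfPlane) : diskToHalfPlane b (halfPlaneToDisk b w) = w := by
  have h1 := add_conj_ne_zero hw hb
  have h2 := one_sub_ne_zero_of_mem_unitDisk (halfPlaneToDisk_mem hw hb)
  rw [diskToHalfPlane, div_eq_iff h2, halfPlaneToDisk]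
  field_simp
  ring

theorem differentiableOn_diskToHalfPlane (b : ℂ) :
    DifferentiableOn ℂ (diskToHalfPlane b) unitDisk := by
  unfold diskToHalfPlane
  refine DifferentiableOn.div (by fun_prop) (by fun_prop) fun u hu => ?_
  exact one_sub_ne_zero_of_mem_unitDisk hu

/-- The Schwarz–Pick lemma for holomorphic self-maps of the right half-plane. -/
theorem schwarzPick_rightHalfPlane {φ : ℂ → ℂ} (hd : DifferentiableOn ℂ φ rightHalfPlane)
    (hm : MapsTo φ rightHalfPlane rightHalfPlane) {a b : ℂ} (ha : a ∈ rightHalfPlane)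
    (hb : b ∈ rightHalfPlane) :
    ‖φ a - φ b‖ ^ 2 * (a.re * b.re) ≤ ‖a - b‖ ^ 2 * ((φ a).re * (φ b).re) := by
  -- Conjugating by the conformal maps that send `b` and `φ b` to `0` reduces the claim to the
  -- Schwarz lemma.
  set ψ : ℂ → ℂ := fun u => halfPlaneToDisk (φ b) (φ (diskToHalfPlane b u)) with hψ
  have hψm : MapsTo ψ (Metric.ball 0 1) (Metric.ball 0 1) := fun u hu =>
    halfPlaneToDisk_mem (hm (diskToHalfPlane_mem hb hu)) (hm hb)
  have hcomp : DifferentiableOn ℂ (fun u => φ (diskToHalfPlane b u)) (Metric.ball 0 1) :=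
    hd.comp (differentiableOn_diskToHalfPlane b) fun u hu => diskToHalfPlane_mem hb hu
  have hψd : DifferentiableOn ℂ ψ (Metric.ball 0 1) := by
    refine DifferentiableOn.div (hcomp.sub_const _) (hcomp.add_const _) fun u hu => ?_
    exact add_conj_ne_zero (hm (diskToHalfPlane_mem hb hu)) (hm hb)
  have h0 : ψ 0 = 0 := by simp [hψ, diskToHalfPlane, halfPlaneToDisk]
  have key := Complex.norm_le_norm_of_mapsTo_ball hψd
    (hψm.mono_right Metric.ball_subset_closedBall) h0
    (mem_unitDisk.1 (halfPlaneToDisk_mem ha hb))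
  simp only [hψ, diskToHalfPlane_halfPlaneToDisk ha hb] at key
  rw [halfPlaneToDisk, halfPlaneToDisk, norm_div, norm_div,
    div_le_div_iff₀ (norm_pos_iff.2 (add_conj_ne_zero (hm ha) (hm hb)))
      (norm_pos_iff.2 (add_conj_ne_zero ha hb))] at key
  have h2 := pow_le_pow_left₀ (by positivity) key 2
  rw [mul_pow, mul_pow, normSq_add_conj, normSq_add_conj] at h2
  linarith

/-- The infinitesimal Schwarz–Pick lemma for the right half-plane. -/
theorem norm_deriv_mul_re_le {φ : ℂ → ℂ} (hd : DifferentiableOn ℂ φ rightHalfPlane)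
    (hm : MapsTo φ rightHalfPlane rightHalfPlane) {a : ℂ} (ha : a ∈ rightHalfPlane) :
    ‖deriv φ a‖ * a.re ≤ (φ a).re := by
  have hda : DifferentiableAt ℂ φ a := hd.differentiableAt (isOpen_rightHalfPlane.mem_nhds ha)
  have h1 : Tendsto (fun b => ‖slope φ a b‖ ^ 2 * (a.re * b.re)) (𝓝[≠] a)
      (𝓝 (‖deriv φ a‖ ^ 2 * (a.re * a.re))) := by
    refine ((hasDerivAt_iff_tendsto_slope.1 hda.hasDerivAt).norm.pow 2).mul
      (tendsto_const_nhds.mul ?_)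
    exact (Complex.continuous_re.tendsto a).mono_left nhdsWithin_le_nhds
  have h2 : Tendsto (fun b => (φ a).re * (φ b).re) (𝓝[≠] a) (𝓝 ((φ a).re * (φ a).re)) := by
    refine tendsto_const_nhds.mul ?_
    exact ((Complex.continuous_re.tendsto _).comp hda.continuousAt).mono_left nhdsWithin_le_nhds
  have h3 : ‖deriv φ a‖ ^ 2 * (a.re * a.re) ≤ (φ a).re * (φ a).re := by
    refine le_of_tendsto_of_tendsto h1 h2 ?_
    filter_upwards [self_mem_nhdsWithin,
      nhdsWithin_le_nhds (isOpen_rightHalfPlane.mem_nhds ha)] with b hb hbm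
    have hne : b - a ≠ 0 := sub_ne_zero.2 hb
    have := schwarzPick_rightHalfPlane hd hm ha hbm
    rw [slope_def_field, norm_div, div_pow, norm_sub_rev (φ b), norm_sub_rev b, div_mul_eq_mul_div,
      div_le_iff₀ (by rw [norm_sub_rev]; positivity)]
    linarith
  have h4 : 0 < (φ a).re := hm ha
  refine le_of_sq_le_sq ?_ h4.le
  nlinarith

theorem cayley_re (z : ℂ) :
    (cayley z).re = (1 - Complex.normSq z) / Complex.normSq (1 - z) := by
  simpa [cayley, diskToHalfPlane] using diskToHalfPlane_re 1 z

theorem cayley_mem {z : ℂ} (hz : z ∈ unitDisk) : cayley z ∈ rightHalfPlane := by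
  simpa [cayley, diskToHalfPlane] using diskToHalfPlane_mem (b := 1) (by simp [rightHalfPlane]) hz

theorem cayleyInv_mem {w : ℂ} (hw : w ∈ rightHalfPlane) : cayleyInv w ∈ unitDisk := by
  simpa [cayleyInv, halfPlaneToDisk] using
    halfPlaneToDisk_mem (b := 1) hw (by simp [rightHalfPlane])

theorem cayley_cayleyInv {w : ℂ} (hw : w ∈ rightHalfPlane) : cayley (cayleyInv w) = w := by
  simpa [cayley, cayleyInv, diskToHalfPlane, halfPlaneToDisk] using
    diskToHalfPlane_halfPlaneToDisk (b := 1) hw (by simp [rightHalfPlane])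

theorem add_one_ne_zero_of_mem {w : ℂ} (hw : w ∈ rightHalfPlane) : w + 1 ≠ 0 := by
  simpa using add_conj_ne_zero (b := 1) hw (by simp [rightHalfPlane])

theorem cayleyInv_cayley {z : ℂ} (hz : z ∈ unitDisk) : cayleyInv (cayley z) = z := by
  have h1 := one_sub_ne_zero_of_mem_unitDisk hz
  rw [cayleyInv, div_eq_iff (add_one_ne_zero_of_mem (cayley_mem hz)), cayley]
  field_simp
  ring

theorem one_sub_cayleyInv {w : ℂ} (hw : w ∈ rightHalfPlane) : 1 - cayleyInv w = 2 / (w + 1) := by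
  have := add_one_ne_zero_of_mem hw
  rw [cayleyInv]
  field_simp
  ring

theorem hasDerivAt_cayley {z : ℂ} (hz : z ∈ unitDisk) :
    HasDerivAt cayley (2 / (1 - z) ^ 2) z := by
  have h1 := one_sub_ne_zero_of_mem_unitDisk hz
  refine (((hasDerivAt_id z).const_add 1).div ((hasDerivAt_id z).const_sub 1) h1).congr_deriv ?_
  simp
  ring

theorem hasDerivAt_cayleyInv {w : ℂ} (hw : w ∈ rightHalfPlane) :
    HasDerivAt cayleyInv (2 / (w + 1) ^ 2) w := by
  have h1 := add_one_ne_zero_of_mem hw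
  refine (((hasDerivAt_id w).sub_const 1).div ((hasDerivAt_id w).add_const 1) h1).congr_deriv ?_
  simp
  ring

/-- The **Noshiro–Warschawski theorem**: a holomorphic function on a convex set whose derivative
takes values in a half-plane is injective. -/
theorem injOn_of_re_mul_deriv_pos {S : Set ℂ} (hS : Convex ℝ S) {g g' : ℂ → ℂ} {c : ℂ}
    (hg : ∀ w ∈ S, HasDerivAt g (g' w) w) (hpos : ∀ w ∈ S, 0 < (c * g' w).re) : InjOn g S := by
  intro a ha b hb hab
  by_contra hne
  have hba : b - a ≠ 0 := sub_ne_zero.2 (Ne.symm hne)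
  have hmem : ∀ s ∈ Icc (0 : ℝ) 1, a + (s : ℂ) * (b - a) ∈ S := fun s hs => by
    have := hS.add_smul_sub_mem ha hb hs
    simpa using this
  -- Dividing by `b - a` cancels the direction of the segment, so this real function has derivative
  -- `Re (c g')`; Rolle's theorem then contradicts positivity.
  have hder : ∀ s ∈ Icc (0 : ℝ) 1, HasDerivAt
      (fun s : ℝ => (c * (g (a + (s : ℂ) * (b - a)) / (b - a))).re)
      ((c * g' (a + (s : ℂ) * (b - a))).re) s := fun s hs => by
    have h1 : HasDerivAt (fun s : ℝ => a + (s : ℂ) * (b - a)) (b - a) s := by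
      simpa using ((Complex.ofRealCLM.hasDerivAt (x := s)).mul_const (b - a)).const_add a
    have h2 := (((hg _ (hmem s hs)).comp_of_eq s h1 rfl).div_const (b - a)).const_mul c
    have h3 := Complex.reCLM.hasFDerivAt.comp_hasDerivAt s h2
    rw [mul_div_cancel_right₀ _ hba] at h3
    exact h3
  obtain ⟨s, hs, h0⟩ := exists_hasDerivAt_eq_zero (zero_lt_one' ℝ)
    (fun s hs => (hder s hs).continuousAt.continuousWithinAt) (by simp [hab])
    (fun s hs => hder s (Ioo_subset_Icc_self hs))
  exact (hpos _ (hmem s (Ioo_subset_Icc_self hs))).ne' h0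

/-! ### Semigroups and their generators in half-plane coordinates. -/

/-- The vector field `-f` on the disk, transported to the right half-plane by the Cayley
transform, as a function of the point of the disk. -/
noncomputable def halfPlaneField (f : ℂ → ℂ) (z : ℂ) : ℂ := -(2 * f z) / (1 - z) ^ 2

section Semigroup

variable {f : ℂ → ℂ} {F : ℝ → ℂ → ℂ}

theorem IsHolSemigroup.hasDerivWithinAt_zero (hF : IsHolSemigroup F)
    (hlim : ∀ z ∈ unitDisk, Tendsto (fun t : ℝ => (z - F t z) / (t : ℂ)) (𝓝[>] 0) (𝓝 (f z)))
    {z : ℂ} (hz : z ∈ unitDisk) : HasDerivWithinAt (fun t => F t z) (-f z) (Ici 0) 0 := by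
  rw [← hasDerivWithinAt_Ioi_iff_Ici, hasDerivWithinAt_iff_tendsto_slope' (by simp)]
  refine (hlim z hz).neg.congr fun t => ?_
  rw [slope_def_module, hF.zero z hz, sub_zero, Complex.real_smul, Complex.ofReal_inv]
  ring

theorem IsHolSemigroup.hasDerivWithinAt (hF : IsHolSemigroup F)
    (hlim : ∀ z ∈ unitDisk, Tendsto (fun t : ℝ => (z - F t z) / (t : ℂ)) (𝓝[>] 0) (𝓝 (f z)))
    {z : ℂ} (hz : z ∈ unitDisk) {t : ℝ} (ht : 0 ≤ t) :
    HasDerivWithinAt (fun s => F s z) (-f (F t z)) (Ici t) t := by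
  have h0 := hF.hasDerivWithinAt_zero hlim (hF.mapsTo t ht hz)
  have h1 : HasDerivWithinAt (fun s : ℝ => s - t) 1 (Ici t) t :=
    (hasDerivAt_id t).sub_const t |>.hasDerivWithinAt
  have h2 := HasDerivWithinAt.scomp_of_eq t h0 h1 (fun s hs => mem_Ici.2 (sub_nonneg.2 hs)) (by simp)
  rw [one_smul] at h2
  refine h2.congr_of_mem (fun s hs => ?_) self_mem_Ici
  have := hF.add t (s - t) ht (sub_nonneg.2 hs) z hz
  simpa using this

theorem nonneg_of_hasDerivWithinAt_Ici {D : ℝ → ℝ} {D' : ℝ} (h : HasDerivWithinAt D D' (Ici 0) 0)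
    (h0 : D 0 = 0) (hD : ∀ t, 0 ≤ t → 0 ≤ D t) : 0 ≤ D' := by
  rw [← hasDerivWithinAt_Ioi_iff_Ici, hasDerivWithinAt_iff_tendsto_slope' (by simp)] at h
  refine ge_of_tendsto h ?_
  filter_upwards [self_mem_nhdsWithin] with t ht
  rw [slope_def_field, h0, sub_zero, sub_zero]
  exact div_nonneg (hD t (le_of_lt ht)) (le_of_lt ht)

/-- Schwarz–Pick for a holomorphic self-map of the disk, in half-plane coordinates. -/
theorem schwarzPick_cayley {φ : ℂ → ℂ} (hd : DifferentiableOn ℂ φ unitDisk)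
    (hm : MapsTo φ unitDisk unitDisk) {a b : ℂ} (ha : a ∈ unitDisk) (hb : b ∈ unitDisk) :
    ‖cayley (φ a) - cayley (φ b)‖ ^ 2 * ((cayley a).re * (cayley b).re) ≤
      ‖cayley a - cayley b‖ ^ 2 * ((cayley (φ a)).re * (cayley (φ b)).re) := by
  have hdc : DifferentiableOn ℂ (fun w => cayley (φ (cayleyInv w))) rightHalfPlane := by
    intro w hw
    have h1 : DifferentiableAt ℂ φ (cayleyInv w) :=
      hd.differentiableAt (isOpen_unitDisk.mem_nhds (cayleyInv_mem hw))
    have h2 := (hasDerivAt_cayley (hm (cayleyInv_mem hw))).differentiableAt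
    exact ((h2.comp _ h1).comp w
      (hasDerivAt_cayleyInv hw).differentiableAt).differentiableWithinAt
  have := schwarzPick_rightHalfPlane hdc
    (fun w hw => cayley_mem (hm (cayleyInv_mem hw))) (cayley_mem ha) (cayley_mem hb)
  simpa only [cayleyInv_cayley ha, cayleyInv_cayley hb] using this

/-- The monotonicity of infinitesimal generators with respect to the hyperbolic metric. -/
theorem IsHolSemigroup.two_mul_inner_le (hF : IsHolSemigroup F)
    (hlim : ∀ z ∈ unitDisk, Tendsto (fun t : ℝ => (z - F t z) / (t : ℂ)) (𝓝[>] 0) (𝓝 (f z)))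
    {a b : ℂ} (ha : a ∈ unitDisk) (hb : b ∈ unitDisk) :
    2 * inner ℝ (cayley a - cayley b) (halfPlaneField f a - halfPlaneField f b) *
        ((cayley a).re * (cayley b).re) ≤
      ‖cayley a - cayley b‖ ^ 2 * ((halfPlaneField f a).re * (cayley b).re +
        (cayley a).re * (halfPlaneField f b).re) := by
  have hW : ∀ z ∈ unitDisk,
      HasDerivWithinAt (fun t => cayley (F t z)) (halfPlaneField f z) (Ici 0) 0 := by
    intro z hz
    have h1 := hasDerivAt_cayley (hF.mapsTo 0 le_rfl hz)
    have h2 := h1.comp_hasDerivWithinAt (0 : ℝ) (hF.hasDerivWithinAt_zero hlim hz)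
    refine h2.congr_deriv ?_
    rw [hF.zero z hz, halfPlaneField]
    ring
  have hre : ∀ z ∈ unitDisk, HasDerivWithinAt (fun t => (cayley (F t z)).re)
      (halfPlaneField f z).re (Ici 0) 0 := fun z hz =>
    Complex.reCLM.hasFDerivAt.comp_hasDerivWithinAt _ (hW z hz)
  have hn := ((hW a ha).sub (hW b hb)).norm_sq
  -- The difference of the two sides of Schwarz–Pick for `F t` is nonnegative and vanishes at `t =
  -- 0`, so its right derivative there is nonnegative.
  have hD := (((hre a ha).mul (hre b hb)).const_mul (‖cayley a - cayley b‖ ^ 2)).sub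
    (hn.mul_const ((cayley a).re * (cayley b).re))
  have h0 := nonneg_of_hasDerivWithinAt_Ici hD
    (by simp [hF.zero a ha, hF.zero b hb]) (fun t ht => by
      have := schwarzPick_cayley (hF.holomorphic t ht) (hF.mapsTo t ht) ha hb
      simpa using this)
  simp only [Pi.sub_apply, hF.zero a ha, hF.zero b hb] at h0
  linarith

end Semigroup

/-! ### Julia's inequality and the Abel function `G`. -/

section GPlusOne

variable {f : ℂ → ℂ} {β : ℝ}

theorem IsGPlusOne.differentiableOn (hf : IsGPlusOne f β) : DifferentiableOn ℂ f unitDisk :=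
  hf.generator.1

/-- The **Julia inequality** for generators: the field in half-plane coordinates dominates `β`
times the real part of the point. -/
theorem IsGPlusOne.julia (hf : IsGPlusOne f β) {z : ℂ} (hz : z ∈ unitDisk) :
    β * (cayley z).re ≤ (halfPlaneField f z).re := by
  obtain ⟨-, F, hF, hlim⟩ := hf.generator
  have hr1 : Tendsto (fun r : ℝ => (r : ℂ)) (𝓝[<] 1) (𝓝 1) := by
    have := (Complex.continuous_ofReal.tendsto 1).mono_left (nhdsWithin_le_nhds (s := Iio (1 : ℝ)))
    simpa using this
  have hβ : Tendsto (fun r : ℝ => f r / ((r : ℂ) - 1)) (𝓝[<] 1) (𝓝 β) :=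
    (hf.angular_deriv 2 (by norm_num)).comp
      (Complex.nhdsWithin_lt_le_nhdsWithin_stolzSet (by norm_num))
  -- `1 / ε r` is the Cayley image of `r`. The two-point inequality is used for `z` and `r`, with `r
  -- → 1`.
  set ε : ℝ → ℝ := fun r => (1 - r) / (1 + r) with hε
  have hεlim : Tendsto (fun r => (ε r : ℂ)) (𝓝[<] 1) (𝓝 0) := by
    have h : Tendsto (fun r : ℝ => (1 - (r : ℂ)) / (1 + r)) (𝓝[<] 1) (𝓝 ((1 - 1) / (1 + 1))) :=
      (tendsto_const_nhds.sub hr1).div (tendsto_const_nhds.add hr1) (by norm_num)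
    simpa [hε] using h
  have hV : Tendsto (fun r : ℝ => (ε r : ℂ) * halfPlaneField f r) (𝓝[<] 1) (𝓝 β) := by
    have h : Tendsto (fun r : ℝ => 2 / (1 + (r : ℂ)) * (f r / ((r : ℂ) - 1))) (𝓝[<] 1)
        (𝓝 (2 / (1 + 1) * β)) :=
      (tendsto_const_nhds.div (tendsto_const_nhds.add hr1) (by norm_num)).mul hβ
    have e : (2 / (1 + 1) * β : ℂ) = β := by norm_num
    rw [e] at h
    refine h.congr' ?_
    filter_upwards [Ioo_mem_nhdsLT (show (0 : ℝ) < 1 by norm_num)] with r hr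
    have h1 : (1 : ℂ) - r ≠ 0 := by
      exact_mod_cast (sub_pos.2 hr.2).ne'
    have h2 : (1 : ℂ) + r ≠ 0 := by exact_mod_cast (by linarith [hr.1] : (0 : ℝ) < 1 + r).ne'
    have h3 : (r : ℂ) - 1 = -(1 - r) := by ring
    rw [halfPlaneField, h3, hε]
    push_cast
    field_simp
  have hL : Tendsto (fun r : ℝ =>
      2 * inner ℝ ((ε r : ℂ) * cayley z - 1)
        ((ε r : ℂ) * halfPlaneField f z - (ε r : ℂ) * halfPlaneField f r) * (cayley z).re)
      (𝓝[<] 1) (𝓝 (2 * inner ℝ (0 * cayley z - 1) (0 * halfPlaneField f z - (β : ℂ)) *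
        (cayley z).re)) :=
    ((Tendsto.inner ((hεlim.mul_const _).sub_const 1)
      ((hεlim.mul_const _).sub hV)).const_mul 2).mul_const _
  have hR : Tendsto (fun r : ℝ => ‖(ε r : ℂ) * cayley z - 1‖ ^ 2 * ((halfPlaneField f z).re +
        (cayley z).re * ((ε r : ℂ) * halfPlaneField f r).re)) (𝓝[<] 1)
      (𝓝 (‖(0 : ℂ) * cayley z - 1‖ ^ 2 * ((halfPlaneField f z).re +
        (cayley z).re * (β : ℂ).re))) := by
    refine (((hεlim.mul_const _).sub_const 1).norm.pow 2).mul
      (tendsto_const_nhds.add (tendsto_const_nhds.mul ?_))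
    exact (Complex.continuous_re.tendsto _).comp hV
  have key := le_of_tendsto_of_tendsto hL hR ?_
  · simp at key
    linarith
  · filter_upwards [Ioo_mem_nhdsLT (show (0 : ℝ) < 1 by norm_num)] with r hr
    have hrm : (r : ℂ) ∈ unitDisk := by
      rw [mem_unitDisk, Complex.norm_real, Real.norm_of_nonneg hr.1.le]
      exact hr.2
    have hε0 : 0 < ε r := div_pos (sub_pos.2 hr.2) (by linarith [hr.1])
    have hc : cayley r = ((ε r)⁻¹ : ℝ) := by
      simp [cayley, hε]
    have h := hF.two_mul_inner_le hlim hz hrm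
    rw [hc] at h
    rw [Complex.ofReal_re] at h
    have hne : (ε r : ℂ) ≠ 0 := by exact_mod_cast hε0.ne'
    have e1 : (ε r : ℂ) * cayley z - 1 = ε r • (cayley z - ((ε r)⁻¹ : ℝ)) := by
      rw [Complex.real_smul, mul_sub, Complex.ofReal_inv, mul_inv_cancel₀ hne]
    have e2 : (ε r : ℂ) * halfPlaneField f z - (ε r : ℂ) * halfPlaneField f r =
        ε r • (halfPlaneField f z - halfPlaneField f r) := by
      rw [Complex.real_smul, mul_sub]
    rw [e1, e2, real_inner_smul_left, real_inner_smul_right, norm_smul,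
      Real.norm_of_nonneg hε0.le, mul_pow, Complex.re_ofReal_mul]
    -- Two factors `ε` are absorbed by the inner product and by the squared norm; the third cancels
    -- the real part `1 / ε` of the Cayley image of `r`.
    have h' := mul_le_mul_of_nonneg_left h (pow_pos hε0 3).le
    calc _ = _ := ?_
      _ ≤ _ := h'
      _ = _ := ?_
    · field_simp
    · field_simp

theorem IsGPlusOne.halfPlaneField_re_pos (hf : IsGPlusOne f β) {z : ℂ} (hz : z ∈ unitDisk) :
    0 < (halfPlaneField f z).re :=
  (mul_pos hf.pos (cayley_mem hz)).trans_le (hf.julia hz)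

theorem IsGPlusOne.ne_zero (hf : IsGPlusOne f β) {z : ℂ} (hz : z ∈ unitDisk) : f z ≠ 0 := by
  intro h
  have := hf.halfPlaneField_re_pos hz
  simp [halfPlaneField, h] at this

theorem IsGPlusOne.exists_primitive (hf : IsGPlusOne f β) :
    ∃ G : ℂ → ℂ, G 0 = 0 ∧ ∀ z ∈ unitDisk, HasDerivAt G (f z)⁻¹ z := by
  have h : DifferentiableOn ℂ (fun z => (f z)⁻¹) (Metric.ball 0 1) :=
    hf.differentiableOn.inv fun z hz => hf.ne_zero hz
  exact (DifferentiableOn.isExactOn_ball h).with_val_at 0 0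

variable {G : ℂ → ℂ}

theorem hasDerivAt_comp_cayleyInv (hG : ∀ z ∈ unitDisk, HasDerivAt G (f z)⁻¹ z) {w : ℂ}
    (hw : w ∈ rightHalfPlane) :
    HasDerivAt (fun w => G (cayleyInv w)) (-(halfPlaneField f (cayleyInv w))⁻¹) w := by
  refine ((hG _ (cayleyInv_mem hw)).comp w (hasDerivAt_cayleyInv hw)).congr_deriv ?_
  have h1 := add_one_ne_zero_of_mem hw
  rw [halfPlaneField, one_sub_cayleyInv hw, neg_div, inv_neg, neg_neg, inv_div, div_pow,
    div_div, mul_comm]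
  by_cases h : f (cayleyInv w) = 0
  · simp [h]
  · field_simp

theorem re_inv_pos {w : ℂ} (hw : 0 < w.re) : 0 < w⁻¹.re := by
  rw [Complex.inv_re]
  refine div_pos hw (Complex.normSq_pos.2 ?_)
  rintro rfl
  simp at hw

/-- The derivative is `-1 / V` with `Re V > 0`, so Noshiro–Warschawski applies on the convex
half-plane. -/
theorem IsGPlusOne.injOn_primitive_halfPlane (hf : IsGPlusOne f β)
    (hG : ∀ z ∈ unitDisk, HasDerivAt G (f z)⁻¹ z) :
    InjOn (fun w => G (cayleyInv w)) rightHalfPlane := by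
  refine injOn_of_re_mul_deriv_pos (c := -1) convex_rightHalfPlane
    (fun w hw => hasDerivAt_comp_cayleyInv hG hw) fun w hw => ?_
  have := re_inv_pos (hf.halfPlaneField_re_pos (cayleyInv_mem hw))
  simpa using this

/-- The primitive of `1 / f` is an Abel function of the semigroup; so its image of the disk is
invariant under the translations to the left. -/
theorem IsGPlusOne.exists_translate (hf : IsGPlusOne f β)
    (hG : ∀ z ∈ unitDisk, HasDerivAt G (f z)⁻¹ z) {z : ℂ} (hz : z ∈ unitDisk) {t : ℝ}
    (ht : 0 ≤ t) : ∃ z' ∈ unitDisk, G z' = G z - t := by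
  obtain ⟨-, F, hF, hlim⟩ := hf.generator
  refine ⟨F t z, hF.mapsTo t ht hz, ?_⟩
  have hder : ∀ s ∈ Ico 0 t, HasDerivWithinAt (fun s : ℝ => G (F s z) + s) 0 (Ici s) s := by
    intro s hs
    have h1 := (hG _ (hF.mapsTo s hs.1 hz)).comp_hasDerivWithinAt s
      (hF.hasDerivWithinAt hlim hz hs.1)
    have h2 := h1.add (Complex.ofRealCLM.hasDerivWithinAt (x := s) (s := Ici s))
    refine h2.congr_deriv ?_
    have := hf.ne_zero (hF.mapsTo s hs.1 hz)
    simp [this]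
  have hcont : ContinuousOn (fun s : ℝ => G (F s z) + s) (Icc 0 t) := by
    refine ContinuousOn.add ?_ Complex.continuous_ofReal.continuousOn
    refine ContinuousOn.comp (t := unitDisk) (fun z hz => (hG z hz).continuousAt.continuousWithinAt)
      ((hF.continuous z hz).mono Icc_subset_Ici_self) fun s hs => hF.mapsTo s hs.1 hz
  have := constant_of_has_deriv_right_zero hcont hder t ⟨ht, le_rfl⟩
  simp only [hF.zero z hz, Complex.ofReal_zero, add_zero] at this
  rw [← this]
  ring

end GPlusOne

/-! ### Inverses of injective holomorphic functions. -/

section LocalInverse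

variable {S : Set ℂ} {g g' : ℂ → ℂ}

theorem hasStrictDerivAt_of_isOpen (hS : IsOpen S) (hg : ∀ w ∈ S, HasDerivAt g (g' w) w) {w : ℂ}
    (hw : w ∈ S) : HasStrictDerivAt g (g' w) w := by
  have hd : DifferentiableOn ℂ g S := fun w hw => (hg w hw).differentiableAt.differentiableWithinAt
  have h := (hd.analyticAt (hS.mem_nhds hw)).hasStrictDerivAt
  rwa [(hg w hw).deriv] at h

theorem image_mem_nhds_of_hasDerivAt (hS : IsOpen S) (hg : ∀ w ∈ S, HasDerivAt g (g' w) w)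
    (h0 : ∀ w ∈ S, g' w ≠ 0) {w : ℂ} (hw : w ∈ S) : g '' S ∈ 𝓝 (g w) := by
  rw [← (hasStrictDerivAt_of_isOpen hS hg hw).map_nhds_eq (h0 w hw)]
  exact image_mem_map (hS.mem_nhds hw)

theorem hasDerivAt_invFunOn (hS : IsOpen S) (hg : ∀ w ∈ S, HasDerivAt g (g' w) w)
    (h0 : ∀ w ∈ S, g' w ≠ 0) (hinj : InjOn g S) {w : ℂ} (hw : w ∈ S) :
    HasDerivAt (Function.invFunOn g S) (g' w)⁻¹ (g w) := by
  have hleft : ∀ x ∈ S, Function.invFunOn g S (g x) = x := fun x hx => hinj.leftInvOn_invFunOn hx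
  refine HasDerivAt.of_local_left_inverse (f := g) ?_ ?_ (h0 w hw) ?_
  · rw [ContinuousAt, hleft w hw]
    intro N hN
    rw [← (hasStrictDerivAt_of_isOpen hS hg hw).map_nhds_eq (h0 w hw), mem_map, mem_map]
    filter_upwards [hN, hS.mem_nhds hw] with x hx hxS
    simpa [mem_preimage, hleft x hxS] using hx
  · rw [hleft w hw]
    exact hg w hw
  · filter_upwards [image_mem_nhds_of_hasDerivAt hS hg h0 hw] with y hy
    exact Function.invFunOn_eq hy

end LocalInverse

/-! ### The exact width of the image of `G`, and univalence of `exp (lam * G)`. -/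

section Strip

variable {f G : ℂ → ℂ} {β : ℝ}

/-- The image of the disk under the Abel function contains, far to the left, the horizontal
half-strip determined by two of its points. -/
theorem IsGPlusOne.exists_halfStrip_subset (hf : IsGPlusOne f β)
    (hG : ∀ z ∈ unitDisk, HasDerivAt G (f z)⁻¹ z) {a b : ℂ} (ha : a ∈ unitDisk)
    (hb : b ∈ unitDisk) :
    ∃ R : ℝ, ∀ u : ℂ, (G a).im ≤ u.im → u.im ≤ (G b).im → u.re < -R →
      ∃ z ∈ unitDisk, G z = u := by
  have hmem : ∀ s ∈ Icc (0 : ℝ) 1, a + (s : ℂ) * (b - a) ∈ unitDisk := fun s hs => by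
    have := (convex_ball (0 : ℂ) 1).add_smul_sub_mem ha hb hs
    simpa [unitDisk] using this
  have hcont : ContinuousOn (fun s : ℝ => G (a + (s : ℂ) * (b - a))) (Icc 0 1) :=
    ContinuousOn.comp (t := unitDisk) (fun z hz => (hG z hz).continuousAt.continuousWithinAt)
      (by fun_prop) hmem
  -- On the image of the segment from `a` to `b` every intermediate height occurs, with real part at
  -- least `m`; left translations then reach every point of the half-strip to the left of `m`.
  obtain ⟨m, hm⟩ := isCompact_Icc.bddBelow_image (Complex.continuous_re.comp_continuousOn hcont)
  refine ⟨-m, fun u h1 h2 h3 => ?_⟩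
  have hiv := intermediate_value_Icc (zero_le_one' ℝ) (Complex.continuous_im.comp_continuousOn hcont)
  obtain ⟨s, hs, hsu⟩ := hiv (show u.im ∈ _ by constructor <;> simpa)
  have hre : m ≤ (G (a + (s : ℂ) * (b - a))).re := hm (mem_image_of_mem _ hs)
  obtain ⟨z, hz, hzu⟩ := hf.exists_translate hG (hmem s hs)
    (t := (G (a + (s : ℂ) * (b - a))).re - u.re) (by linarith)
  refine ⟨z, hz, ?_⟩
  rw [hzu]
  refine Complex.ext (by simp) ?_
  simpa using hsu

/-- A half-strip of height `d` in the image pulls back to a self-map `k` of the half-plane with `k'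
= V(k) (d / π) / (1 + ζ)`. Schwarz–Pick bounds `|k'(x)| x` by `Re k(x)`, whereas Julia gives `|V(k)|
≥ β Re k`; comparison for large `x` forces `β d ≤ π`. -/
theorem IsGPlusOne.im_sub_le (hf : IsGPlusOne f β) (hG : ∀ z ∈ unitDisk, HasDerivAt G (f z)⁻¹ z)
    {a b : ℂ} (ha : a ∈ unitDisk) (hb : b ∈ unitDisk) :
    (G b).im - (G a).im ≤ Real.pi / β := by
  by_contra! hlt
  set d := (G b).im - (G a).im with hd
  have hd0 : 0 < d := (div_pos Real.pi_pos hf.pos).trans hlt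
  obtain ⟨R, hR⟩ := hf.exists_halfStrip_subset hG ha hb
  set Γ : ℂ → ℂ := fun w => G (cayleyInv w) with hΓ
  have hΓd : ∀ w ∈ rightHalfPlane, HasDerivAt Γ (-(halfPlaneField f (cayleyInv w))⁻¹) w :=
    fun w hw => hasDerivAt_comp_cayleyInv hG hw
  have hV0 : ∀ w ∈ rightHalfPlane, halfPlaneField f (cayleyInv w) ≠ 0 := fun w hw h => by
    have := hf.halfPlaneField_re_pos (cayleyInv_mem hw)
    simp [h] at this
  have hΓ0 : ∀ w ∈ rightHalfPlane, -(halfPlaneField f (cayleyInv w))⁻¹ ≠ 0 :=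
    fun w hw => neg_ne_zero.2 (inv_ne_zero (hV0 w hw))
  set g := Function.invFunOn Γ rightHalfPlane with hg
  set c : ℂ := ⟨-R - 1, ((G a).im + (G b).im) / 2⟩ with hc
  -- On the right half-plane `log (1 + ζ)` has nonnegative real part and argument within `π / 2`, so
  -- `u` takes values in the half-strip of height `d` with vertical midpoint `c.im`.
  set u : ℂ → ℂ := fun ζ => c - ((d / Real.pi : ℝ) : ℂ) * Complex.log (1 + ζ) with hu
  have hdp : 0 < d / Real.pi := div_pos hd0 Real.pi_pos
  have humem : ∀ ζ ∈ rightHalfPlane, u ζ ∈ Γ '' rightHalfPlane := by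
    intro ζ hζ
    have hζ' : 0 < ζ.re := hζ
    have harg : |Complex.arg (1 + ζ)| < Real.pi / 2 :=
      Complex.abs_arg_lt_pi_div_two_iff.2 (Or.inl (by simp; linarith))
    have hlog : 0 ≤ Real.log ‖1 + ζ‖ := by
      refine Real.log_nonneg ?_
      have h1 := Complex.re_le_norm (1 + ζ)
      rw [Complex.add_re, Complex.one_re] at h1
      linarith
    have hlt := abs_lt.1 harg
    have hb1 : d / Real.pi * Complex.arg (1 + ζ) ≤ d / Real.pi * (Real.pi / 2) :=
      mul_le_mul_of_nonneg_left hlt.2.le hdp.le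
    have hb2 : d / Real.pi * (-(Real.pi / 2)) ≤ d / Real.pi * Complex.arg (1 + ζ) :=
      mul_le_mul_of_nonneg_left hlt.1.le hdp.le
    have hhalf : d / Real.pi * (Real.pi / 2) = d / 2 := by
      field_simp
    have him : (u ζ).im = ((G a).im + (G b).im) / 2 - d / Real.pi * Complex.arg (1 + ζ) := by
      rw [hu, Complex.sub_im, Complex.im_ofReal_mul, Complex.log_im]
    have hre : (u ζ).re = -R - 1 - d / Real.pi * Real.log ‖1 + ζ‖ := by
      rw [hu, Complex.sub_re, Complex.re_ofReal_mul, Complex.log_re]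
    obtain ⟨z, hz, hzu⟩ := hR (u ζ) (by rw [him]; linarith) (by rw [him]; linarith)
      (by rw [hre]; nlinarith [mul_nonneg hdp.le hlog])
    exact ⟨cayley z, cayley_mem hz, by simp only [hΓ]; rw [cayleyInv_cayley hz, hzu]⟩
  set k : ℂ → ℂ := fun ζ => g (u ζ) with hk
  have hkm : MapsTo k rightHalfPlane rightHalfPlane := fun ζ hζ =>
    Function.invFunOn_mem (humem ζ hζ)
  have hkd : ∀ ζ ∈ rightHalfPlane, HasDerivAt k
      (halfPlaneField f (cayleyInv (k ζ)) * ((d / Real.pi : ℝ) / (1 + ζ))) ζ := by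
    intro ζ hζ
    have hζ' : 0 < ζ.re := hζ
    have h1 := hasDerivAt_invFunOn isOpen_rightHalfPlane hΓd hΓ0 (hf.injOn_primitive_halfPlane hG)
      (hkm hζ)
    have h2 : Γ (k ζ) = u ζ := Function.invFunOn_eq (humem ζ hζ)
    have h3 : HasDerivAt u (-((d / Real.pi : ℝ) / (1 + ζ))) ζ := by
      have := (((hasDerivAt_id ζ).const_add 1).clog (by left; simp; linarith)).const_mul
        (((d / Real.pi : ℝ) : ℂ)) |>.const_sub c
      refine this.congr_deriv ?_
      simp
      ring
    rw [h2] at h1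
    refine (h1.comp ζ h3).congr_deriv ?_
    rw [inv_neg, inv_inv]
    ring
  have hineq : ∀ x : ℝ, 0 < x → β * (d / Real.pi) * x ≤ 1 + x := by
    intro x hx
    have hxm : (x : ℂ) ∈ rightHalfPlane := by simpa [rightHalfPlane] using hx
    have h1 := norm_deriv_mul_re_le
      (fun ζ hζ => (hkd ζ hζ).differentiableAt.differentiableWithinAt) hkm hxm
    have h2 := hf.julia (cayleyInv_mem (hkm hxm))
    rw [cayley_cayleyInv (hkm hxm)] at h2
    have h3 : 0 < (k x).re := hkm hxm
    have h4 : ‖((d / Real.pi : ℝ) : ℂ) / (1 + (x : ℂ))‖ = d / Real.pi / (1 + x) := by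
      rw [norm_div, Complex.norm_real, Real.norm_of_nonneg hdp.le,
        show (1 : ℂ) + x = ((1 + x : ℝ) : ℂ) by push_cast; rfl, Complex.norm_real,
        Real.norm_of_nonneg (by linarith)]
    rw [(hkd _ hxm).deriv, norm_mul, h4, Complex.ofReal_re] at h1
    have h5 := h2.trans (Complex.re_le_norm _)
    have h6 : β * (k x).re * (d / Real.pi / (1 + x)) * x ≤ (k x).re :=
      (by gcongr : _ ≤ _).trans h1
    have h7 : β * (k x).re * (d / Real.pi / (1 + x)) * x =
        (β * (d / Real.pi) * x / (1 + x)) * (k x).re := by ring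
    rw [h7] at h6
    have h8 : β * (d / Real.pi) * x / (1 + x) ≤ 1 := by
      by_contra! h
      nlinarith
    rwa [div_le_one (by linarith)] at h8
  have hq : 1 < β * (d / Real.pi) := by
    rw [div_lt_iff₀ hf.pos] at hlt
    rw [← mul_div_assoc, one_lt_div Real.pi_pos]
    linarith
  -- With `q = β d / π > 1` and `x = 2 / (q - 1)` one has `q x = x + 2 > 1 + x`.
  have := hineq (2 / (β * (d / Real.pi) - 1)) (div_pos two_pos (by linarith))
  have h9 : (β * (d / Real.pi) - 1) * (2 / (β * (d / Real.pi) - 1)) = 2 :=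
    mul_div_cancel₀ _ (by linarith)
  linarith

/-- The image is open, so a point slightly above `G b` also belongs to it and the bound cannot be
attained. -/
theorem IsGPlusOne.im_sub_lt (hf : IsGPlusOne f β) (hG : ∀ z ∈ unitDisk, HasDerivAt G (f z)⁻¹ z)
    {a b : ℂ} (ha : a ∈ unitDisk) (hb : b ∈ unitDisk) :
    (G b).im - (G a).im < Real.pi / β := by
  have hn := image_mem_nhds_of_hasDerivAt isOpen_unitDisk hG
    (fun z hz => inv_ne_zero (hf.ne_zero hz)) hb
  have hc : Tendsto (fun s : ℝ => G b + s * Complex.I) (𝓝[>] 0) (𝓝 (G b)) := by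
    have : Continuous (fun s : ℝ => G b + s * Complex.I) := by fun_prop
    have := (this.tendsto 0).mono_left (nhdsWithin_le_nhds (s := Ioi 0))
    simpa using this
  obtain ⟨s, ⟨z, hz, hzs⟩, hs⟩ := ((hc.eventually hn).and self_mem_nhdsWithin).exists
  have h1 := hf.im_sub_le hG ha hz
  rw [hzs] at h1
  have hs' : 0 < s := hs
  simp at h1
  linarith

/-- Lets angular limits at `1` be used along sectors of the half-plane. -/
theorem cayleyInv_mem_stolzSet {w : ℂ} (hw : w ∈ rightHalfPlane) {M : ℝ}
    (h : ‖w + 1‖ < M * w.re) : cayleyInv w ∈ Complex.stolzSet M := by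
  have hz := cayleyInv_mem hw
  have h1 := cayley_re (cayleyInv w)
  have h0 : 0 < ‖w + 1‖ := norm_pos_iff.2 (add_one_ne_zero_of_mem hw)
  have hM : 0 < M := by
    have : 0 < w.re := hw
    by_contra! hM
    nlinarith
  rw [cayley_cayleyInv hw, Complex.normSq_eq_norm_sq, Complex.normSq_eq_norm_sq] at h1
  have h2 : ‖1 - cayleyInv w‖ = 2 / ‖w + 1‖ := by
    rw [one_sub_cayleyInv hw, norm_div]
    simp
  refine ⟨mem_unitDisk.1 hz, ?_⟩
  have hz' := mem_unitDisk.1 hz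
  set n := ‖cayleyInv w‖
  have hn : 0 ≤ n := norm_nonneg _
  rw [h2, eq_div_iff (by positivity)] at h1
  have h3 : 1 - n ^ 2 ≤ 2 * (1 - n) := by nlinarith
  have h4 : 2 / ‖w + 1‖ < M * (w.re * (2 / ‖w + 1‖) ^ 2 / 2) := by
    have : M * (w.re * (2 / ‖w + 1‖) ^ 2 / 2) = (M * w.re) * (2 / ‖w + 1‖ ^ 2) := by
      field_simp
    rw [this]
    calc 2 / ‖w + 1‖ = ‖w + 1‖ * (2 / ‖w + 1‖ ^ 2) := by field_simp
      _ < _ := by gcongr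
  rw [h2]
  refine h4.trans_le ?_
  rw [h1]
  gcongr
  linarith

theorem polar_re (x s : ℝ) : ((x : ℂ) * Complex.exp (s * Complex.I)).re = x * Real.cos s := by
  rw [Complex.re_ofReal_mul, Complex.exp_ofReal_mul_I_re]

theorem norm_polar {x : ℝ} (hx : 0 ≤ x) (s : ℝ) : ‖(x : ℂ) * Complex.exp (s * Complex.I)‖ = x := by
  rw [norm_mul, Complex.norm_exp_ofReal_mul_I, mul_one, Complex.norm_real, Real.norm_of_nonneg hx]

/-- The angular derivative governs the field uniformly in sectors of the half-plane. -/
theorem IsGPlusOne.tendsto_div_halfPlaneField (hf : IsGPlusOne f β) {θ : ℝ} (hθ0 : 0 < θ)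
    (hθ : θ < Real.pi / 2) :
    Tendsto (fun y : ℝ × ℝ => ((y.1 : ℂ) * Complex.exp (y.2 * Complex.I)) /
        halfPlaneField f (cayleyInv ((y.1 : ℂ) * Complex.exp (y.2 * Complex.I))))
      (atTop ×ˢ 𝓟 (Icc (-θ) θ)) (𝓝 (β : ℂ)⁻¹) := by
  set l : Filter (ℝ × ℝ) := atTop ×ˢ 𝓟 (Icc (-θ) θ) with hl
  set w : ℝ × ℝ → ℂ := fun y => (y.1 : ℂ) * Complex.exp (y.2 * Complex.I) with hw
  have hcos : 0 < Real.cos θ := Real.cos_pos_of_mem_Ioo ⟨by linarith, hθ⟩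
  have h1 : ∀ᶠ y in l, 1 < y.1 := (eventually_gt_atTop 1).prod_inl _
  have h2 : ∀ᶠ y in l, y.2 ∈ Icc (-θ) θ := (eventually_principal.2 fun _ h => h).prod_inr _
  have hcosy : ∀ᶠ y in l, Real.cos θ ≤ Real.cos y.2 := by
    filter_upwards [h2] with y hy
    rw [← Real.cos_abs y.2]
    exact Real.cos_le_cos_of_nonneg_of_le_pi (abs_nonneg _) (by linarith [Real.pi_pos])
      (abs_le.2 hy)
  have hwm : ∀ᶠ y in l, w y ∈ rightHalfPlane := by
    filter_upwards [h1, hcosy] with y hy1 hy2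
    change 0 < (w y).re
    rw [hw, polar_re]
    exact mul_pos (by linarith) (hcos.trans_le hy2)
  have hwst : ∀ᶠ y in l, cayleyInv (w y) ∈ Complex.stolzSet (2 / Real.cos θ + 1) := by
    filter_upwards [h1, hcosy, hwm] with y hy1 hy2 hy3
    refine cayleyInv_mem_stolzSet hy3 ?_
    have e1 : ‖w y + 1‖ ≤ y.1 + 1 := by
      have := norm_add_le (w y) 1
      rwa [hw, norm_polar (by linarith), norm_one] at this
    have e2 : y.1 * Real.cos θ ≤ (w y).re := by
      rw [hw, polar_re]
      gcongr
    calc ‖w y + 1‖ ≤ y.1 + 1 := e1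
      _ < (2 / Real.cos θ + 1) * (y.1 * Real.cos θ) := by
        have : (2 / Real.cos θ + 1) * (y.1 * Real.cos θ) = 2 * y.1 + y.1 * Real.cos θ := by
          field_simp
        rw [this]
        have : 0 < y.1 * Real.cos θ := mul_pos (by linarith) hcos
        linarith
      _ ≤ _ := by gcongr
  have hwinf : Tendsto (fun y => ‖w y + 1‖) l atTop := by
    have h3 : Tendsto (fun y : ℝ × ℝ => y.1 - 1) l atTop :=
      tendsto_atTop_add_const_right _ _ tendsto_fst
    refine tendsto_atTop_mono' l ?_ h3
    filter_upwards [h1] with y hy1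
    have := norm_sub_le (w y + 1) 1
    rw [add_sub_cancel_right, norm_one] at this
    rw [hw, norm_polar (by linarith)] at this
    linarith
  have hinv : Tendsto (fun y => (w y + 1)⁻¹) l (𝓝 0) := by
    rw [tendsto_zero_iff_norm_tendsto_zero]
    exact hwinf.inv_tendsto_atTop.congr fun y => by simp
  have hz1 : Tendsto (fun y => cayleyInv (w y)) l (𝓝 1) := by
    have : Tendsto (fun y => 1 - 2 * (w y + 1)⁻¹) l (𝓝 (1 - 2 * 0)) :=
      tendsto_const_nhds.sub (hinv.const_mul 2)
    rw [mul_zero, sub_zero] at this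
    refine this.congr' ?_
    filter_upwards [hwm] with y hy
    rw [← div_eq_mul_inv, ← one_sub_cayleyInv hy]
    ring
  have hzst : Tendsto (fun y => cayleyInv (w y)) l
      (𝓝[Complex.stolzSet (2 / Real.cos θ + 1)] 1) :=
    tendsto_nhdsWithin_iff.2 ⟨hz1, hwst⟩
  have hβ := (hf.angular_deriv _ (by
    have : 0 < 2 / Real.cos θ := by positivity
    linarith)).comp hzst
  have hβ0 : (β : ℂ) ≠ 0 := by exact_mod_cast hf.pos.ne'
  -- Since `1 - z = 2 / (w + 1)`, the field is `V = (w + 1) f(z) / (z - 1)`, hence `w / V = (1 - 1 /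
  -- (w + 1)) (f(z) / (z - 1))⁻¹`.
  have hlim : Tendsto (fun y => (1 - (w y + 1)⁻¹) *
      (f (cayleyInv (w y)) / (cayleyInv (w y) - 1))⁻¹) l (𝓝 ((1 - 0) * (β : ℂ)⁻¹)) :=
    (tendsto_const_nhds.sub hinv).mul (hβ.inv₀ hβ0)
  rw [sub_zero, one_mul] at hlim
  refine hlim.congr' ?_
  filter_upwards [hwm] with y hy
  change _ = w y / halfPlaneField f (cayleyInv (w y))
  have e1 := add_one_ne_zero_of_mem hy
  have e2 := hf.ne_zero (cayleyInv_mem hy)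
  rw [halfPlaneField, ← neg_sub 1 (cayleyInv (w y)), one_sub_cayleyInv hy]
  field_simp
  ring

/-- Along an arc `x e^{is}`, `|s| ≤ θ`, the derivative of `G` in `s` is `-i w / V`, which is close
to `-i / β` for large `x`; the heights then vary by nearly `2θ / β`, and `θ` may approach `π / 2`.
-/
theorem IsGPlusOne.exists_lt_im_sub (hf : IsGPlusOne f β)
    (hG : ∀ z ∈ unitDisk, HasDerivAt G (f z)⁻¹ z) {δ : ℝ} (hδ : δ < Real.pi / β) :
    ∃ a ∈ unitDisk, ∃ b ∈ unitDisk, δ < (G b).im - (G a).im := by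
  have hβ := hf.pos
  obtain ⟨θ, hθ1, hθ2⟩ : ∃ θ, max 0 (β * δ / 2) < θ ∧ θ < Real.pi / 2 := by
    refine exists_between (max_lt (by positivity) ?_)
    rw [lt_div_iff₀ hβ] at hδ
    linarith
  have hθ0 : 0 < θ := (le_max_left _ _).trans_lt hθ1
  have hθδ : δ < 2 * θ / β := by
    rw [lt_div_iff₀ hβ]
    linarith [(le_max_right _ _).trans_lt hθ1]
  obtain ⟨ε, hε0, hε⟩ : ∃ ε, 0 < ε ∧ δ + ε * (2 * θ) < 2 * θ / β := by
    -- The error accumulated over the arc of angle `2θ` is then half of the available slack.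
    refine ⟨(2 * θ / β - δ) / (4 * θ), div_pos (by linarith) (by linarith), ?_⟩
    have : (2 * θ / β - δ) / (4 * θ) * (2 * θ) = (2 * θ / β - δ) / 2 := by
      field_simp
      ring
    rw [this]
    linarith
  have hlim := (Metric.tendsto_nhds.1 (hf.tendsto_div_halfPlaneField hθ0 hθ2)) ε hε0
  rw [eventually_prod_principal_iff] at hlim
  obtain ⟨x, hx, hx0⟩ := (hlim.and (eventually_gt_atTop 0)).exists
  have hmem : ∀ s ∈ Icc (-θ) θ, (x : ℂ) * Complex.exp (s * Complex.I) ∈ rightHalfPlane := by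
    intro s hs
    change 0 < ((x : ℂ) * Complex.exp (s * Complex.I)).re
    rw [polar_re]
    exact mul_pos hx0 (Real.cos_pos_of_mem_Ioo ⟨by linarith [hs.1], by linarith [hs.2]⟩)
  -- The deviation of `G` from its model `-i s / β`. The height decreases with `s`, so the lower
  -- point is the endpoint `θ`.
  set Φ : ℝ → ℂ := fun s => G (cayleyInv ((x : ℂ) * Complex.exp (s * Complex.I))) +
    (s : ℂ) * (Complex.I * (β : ℂ)⁻¹) with hΦ
  have hder : ∀ s ∈ Icc (-θ) θ, HasDerivWithinAt Φ (Complex.I * ((β : ℂ)⁻¹ -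
      ((x : ℂ) * Complex.exp (s * Complex.I)) / halfPlaneField f (cayleyInv
        ((x : ℂ) * Complex.exp (s * Complex.I))))) (Icc (-θ) θ) s := by
    intro s hs
    have h1 : HasDerivAt (fun s : ℝ => (x : ℂ) * Complex.exp (s * Complex.I))
        ((x : ℂ) * (Complex.exp (s * Complex.I) * Complex.I)) s := by
      have := ((Complex.ofRealCLM.hasDerivAt (x := s)).mul_const Complex.I).cexp.const_mul (x : ℂ)
      simpa using this
    have h2 := (hasDerivAt_comp_cayleyInv hG (hmem s hs)).comp_of_eq s h1 rfl
    have h3 := (Complex.ofRealCLM.hasDerivAt (x := s)).mul_const (Complex.I * (β : ℂ)⁻¹)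
    refine ((h2.add h3).congr_deriv ?_).hasDerivWithinAt
    simp only [Complex.ofRealCLM_apply, Complex.ofReal_one]
    ring
  have hbound := (convex_Icc (-θ) θ).norm_image_sub_le_of_norm_hasDerivWithin_le (C := ε) hder
    (fun s hs => by
      have := hx s hs
      rw [dist_comm, dist_eq_norm] at this
      rw [norm_mul, Complex.norm_I, one_mul]
      exact this.le) (left_mem_Icc.2 (by linarith)) (right_mem_Icc.2 (by linarith))
  refine ⟨_, cayleyInv_mem (hmem θ (right_mem_Icc.2 (by linarith))), _,
    cayleyInv_mem (hmem (-θ) (left_mem_Icc.2 (by linarith))), ?_⟩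
  have h1 := (Complex.abs_im_le_norm _).trans hbound
  rw [Real.norm_of_nonneg (by linarith : 0 ≤ θ - -θ)] at h1
  have h2 := (abs_le.1 h1).2
  have h3 : ∀ s : ℝ, ((s : ℂ) * (Complex.I * (β : ℂ)⁻¹)).im = s / β := fun s => by
    rw [← Complex.ofReal_inv, Complex.im_ofReal_mul, Complex.im_mul_ofReal, Complex.I_im]
    ring
  simp only [hΦ, Complex.sub_im, Complex.add_im, h3] at h2
  have h4 : θ / β - -θ / β = 2 * θ / β := by ring
  linarith

/-- A collision means that two points of the image differ by a multiple of the period `2πi / lam`. A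
period of smaller height fits into a half-strip contained in the image; for one of height at least
`π / β`, every nonzero multiple exceeds the strict bound on heights. -/
theorem IsGPlusOne.injOn_exp_iff (hf : IsGPlusOne f β)
    (hG : ∀ z ∈ unitDisk, HasDerivAt G (f z)⁻¹ z) {lam : ℂ} (hlam : lam ≠ 0) :
    InjOn (fun z => Complex.exp (lam * G z)) unitDisk ↔
      Real.pi / β ≤ |(2 * Real.pi * Complex.I / lam).im| := by
  have hperiod : lam * (2 * Real.pi * Complex.I / lam) = 2 * Real.pi * Complex.I :=
    mul_div_cancel₀ _ hlam
  constructor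
  · intro hinj
    by_contra! hlt
    set ω := 2 * Real.pi * Complex.I / lam with hω
    have hω0 : ω ≠ 0 := by
      intro h
      rw [h, mul_zero] at hperiod
      exact Complex.two_pi_I_ne_zero hperiod.symm
    obtain ⟨a, ha, b, hb, hab⟩ := hf.exists_lt_im_sub hG hlt
    obtain ⟨R, hR⟩ := hf.exists_halfStrip_subset hG ha hb
    obtain ⟨v, hv1, hv2, hv3, hv4⟩ : ∃ v : ℝ, (G a).im ≤ v ∧ v ≤ (G b).im ∧
        (G a).im ≤ v + ω.im ∧ v + ω.im ≤ (G b).im := by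
      rcases le_total 0 ω.im with h | h
      · rw [abs_of_nonneg h] at hab
        exact ⟨(G a).im, by linarith, by linarith, by linarith, by linarith⟩
      · rw [abs_of_nonpos h] at hab
        exact ⟨(G b).im, by linarith, by linarith, by linarith, by linarith⟩
    -- The term `|ω.re|` keeps the point shifted by `ω` to the left of `-R` as well.
    obtain ⟨z, hz, hzu⟩ := hR ⟨-R - 1 - |ω.re|, v⟩ hv1 hv2
      (by simp only; linarith [abs_nonneg ω.re])
    obtain ⟨z', hz', hzu'⟩ := hR (⟨-R - 1 - |ω.re|, v⟩ + ω) hv3 hv4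
      (by simp only [Complex.add_re]; linarith [le_abs_self ω.re])
    have heq : z' = z := by
      refine hinj hz' hz ?_
      simp only
      rw [hzu', ← hzu, mul_add, hperiod, Complex.exp_add, Complex.exp_two_pi_mul_I, mul_one]
    rw [heq, hzu] at hzu'
    exact hω0 (by simpa using hzu')
  · intro hle a ha b hb hab
    obtain ⟨n, hn⟩ := Complex.exp_eq_exp_iff_exists_int.1 hab
    have h1 : G a - G b = n * (2 * Real.pi * Complex.I / lam) := by
      field_simp
      linear_combination hn
    have h2 : |(G a).im - (G b).im| < Real.pi / β :=
      abs_sub_lt_iff.2 ⟨hf.im_sub_lt hG hb ha, hf.im_sub_lt hG ha hb⟩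
    have h3 : (G a).im - (G b).im = n * (2 * Real.pi * Complex.I / lam).im := by
      rw [← Complex.sub_im, h1, ← Complex.ofReal_intCast, Complex.im_ofReal_mul]
    rw [h3, abs_mul] at h2
    have hn0 : n = 0 := by
      by_contra hn0
      have : (1 : ℝ) ≤ |(n : ℝ)| := by exact_mod_cast Int.one_le_abs hn0
      nlinarith [abs_nonneg (2 * Real.pi * Complex.I / lam).im]
    rw [hn0, Int.cast_zero, zero_mul, sub_eq_zero] at h1
    have h4 := hf.injOn_primitive_halfPlane hG (cayley_mem ha) (cayley_mem hb)
      (by simpa only [cayleyInv_cayley ha, cayleyInv_cayley hb] using h1)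
    rw [← cayleyInv_cayley ha, ← cayleyInv_cayley hb, h4]

/-! ### The disks `Ω₊` and `Ω₋` as conditions on the period. -/

theorem norm_sub_real_le_iff {β : ℝ} (hβ : 0 < β) (ω : ℂ) :
    ‖ω - (β : ℂ)‖ ≤ β ↔ Complex.normSq ω ≤ 2 * β * ω.re := by
  rw [← sq_le_sq₀ (norm_nonneg _) hβ.le, ← Complex.normSq_eq_norm_sq]
  simp only [Complex.normSq_apply, Complex.sub_re, Complex.sub_im, Complex.ofReal_re,
    Complex.ofReal_im]
  constructor <;> intro h <;> nlinarith

theorem mem_omegaPlus_iff {β : ℝ} (hβ : 0 < β) (ω : ℂ) :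
    ω ∈ OmegaPlus β ↔ Complex.normSq ω ≤ 2 * β * ω.re ∧ ω ≠ 0 := by
  rw [← norm_sub_real_le_iff hβ]
  rfl

theorem neg_mem_omegaPlus {β : ℝ} {ω : ℂ} : -ω ∈ OmegaPlus β ↔ ω ∈ OmegaMinus β := by
  change ‖-ω - β‖ ≤ β ∧ -ω ≠ 0 ↔ ‖ω + β‖ ≤ β ∧ ω ≠ 0
  rw [← norm_neg (-ω - β), neg_ne_zero, neg_sub, sub_neg_eq_add, add_comm]

/-- Both sides say `|lam|² ≤ 2β |Re lam|`, because `Im (2πi / lam) = 2π Re lam / |lam|²`. -/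
theorem mem_omega_union_iff {β : ℝ} (hβ : 0 < β) {lam : ℂ} (hlam : lam ≠ 0) :
    lam ∈ OmegaPlus β ∪ OmegaMinus β ↔
      Real.pi / β ≤ |(2 * Real.pi * Complex.I / lam).im| := by
  have hn : 0 < Complex.normSq lam := Complex.normSq_pos.2 hlam
  have him : (2 * Real.pi * Complex.I / lam).im = 2 * Real.pi * lam.re / Complex.normSq lam := by
    rw [Complex.div_im]
    simp
  rw [mem_union, ← neg_mem_omegaPlus, mem_omegaPlus_iff hβ, mem_omegaPlus_iff hβ, him, abs_div,
    abs_of_pos hn, abs_mul, abs_of_pos Real.two_pi_pos, div_le_div_iff₀ hβ hn, Complex.normSq_neg,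
    Complex.neg_re]
  have e : Real.pi * Complex.normSq lam ≤ 2 * Real.pi * |lam.re| * β ↔
      Complex.normSq lam ≤ 2 * β * |lam.re| := by
    rw [show 2 * Real.pi * |lam.re| * β = Real.pi * (2 * β * |lam.re|) by ring,
      mul_le_mul_iff_right₀ Real.pi_pos]
  rw [e]
  simp only [hlam, ne_eq, neg_eq_zero, not_false_eq_true, and_true]
  rcases le_total 0 lam.re with h | h
  · rw [abs_of_nonneg h]
    refine ⟨fun h' => h'.elim id fun h' => ?_, Or.inl⟩
    nlinarith [mul_nonneg hβ.le h]
  · rw [abs_of_nonpos h]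
    refine ⟨fun h' => h'.elim (fun h' => ?_) id, Or.inr⟩
    nlinarith [mul_nonneg hβ.le (neg_nonneg.2 h)]

end Strip

/-! ### Spirallike functions vanishing at the origin. -/

section SpirallikeAtZero

variable {p h : ℂ → ℂ}

/-- If `h` solves the spirallikeness equation `μ h = h' z p` with `0 < re p`, then the image of
every closed disk about the origin contains the spirals of its points. -/
theorem spiral_mem_image (hd : ∀ z ∈ unitDisk, HasDerivAt h (deriv h z) z)
    (hinj : InjOn h unitDisk) (h0 : h 0 = 0) (hne : ∀ z ∈ unitDisk, deriv h z ≠ 0) {μ : ℂ}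
    (heq : ∀ z ∈ unitDisk, μ * h z = deriv h z * (z * p z)) (hp : ∀ z ∈ unitDisk, 0 < (p z).re)
    {z₀ : ℂ} (hz₀ : z₀ ∈ unitDisk) {t : ℝ} (ht : 0 ≤ t) :
    Complex.exp (-(t : ℂ) * μ) * h z₀ ∈ h '' unitDisk := by
  have hsub : Metric.closedBall (0 : ℂ) ‖z₀‖ ⊆ unitDisk :=
    Metric.closedBall_subset_ball (mem_unitDisk.1 hz₀)
  have hcomp : IsCompact (h '' Metric.closedBall 0 ‖z₀‖) :=
    (isCompact_closedBall _ _).image_of_continuousOn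
      fun z hz => (hd z (hsub hz)).continuousAt.continuousWithinAt
  set γ : ℝ → ℂ := fun s => Complex.exp (-(s : ℂ) * μ) * h z₀ with hγ
  have hγd : ∀ s, HasDerivAt γ (-μ * γ s) s := fun s => by
    have h1 := (((Complex.ofRealCLM.hasDerivAt (x := s)).neg.mul_const μ).cexp).mul_const (h z₀)
    refine h1.congr_deriv ?_
    simp only [hγ, Pi.neg_apply, Complex.ofRealCLM_apply, Complex.ofReal_one]
    ring
  have hγc : Continuous γ := continuous_iff_continuousAt.2 fun s => (hγd s).continuousAt
  -- Continuous induction along the spiral: the times at which it lies in the image of the closed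
  -- disk form a closed set, and each such time can be exceeded because the preimage moves with
  -- velocity `-z p`, which decreases `|z|`.
  have hind := IsClosed.Icc_subset_of_forall_exists_gt (a := 0) (b := t)
    (s := γ ⁻¹' (h '' Metric.closedBall 0 ‖z₀‖))
    ((hcomp.isClosed.preimage hγc).inter isClosed_Icc)
    ⟨z₀, by simp, by simp [hγ]⟩ ?_
  · obtain ⟨z, hz, hzt⟩ := hind (right_mem_Icc.2 ht)
    exact ⟨z, hsub hz, hzt⟩
  · rintro x ⟨⟨z, hz, hzx⟩, -⟩ y hy
    have hzd := hsub hz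
    have hz' : ‖z‖ ≤ ‖z₀‖ := by simpa using hz
    rcases eq_or_ne z 0 with rfl | hz0
    -- Here the spiral is constantly `0`.
    · refine ⟨y, ⟨0, by simp, ?_⟩, hy, le_rfl⟩
      rw [h0] at hzx ⊢
      have : h z₀ = 0 := by
        simpa [hγ] using hzx.symm
      simp [hγ, this]
    · have hleft : Function.invFunOn h unitDisk (h z) = z := hinj.leftInvOn_invFunOn hzd
      have hg := hasDerivAt_invFunOn isOpen_unitDisk hd hne hinj hzd
      have hc : HasDerivAt (fun s => Function.invFunOn h unitDisk (γ s)) (-(z * p z)) x := by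
        refine (hg.comp_of_eq x (hγd x) hzx).congr_deriv ?_
        have := hne z hzd
        rw [← hzx, neg_mul, heq z hzd]
        field_simp
      have hn := hc.norm_sq
      rw [← hzx, hleft] at hn
      have hneg : 2 * inner ℝ z (-(z * p z)) < 0 := by
        have h1 : inner ℝ z (z * p z) = Complex.normSq z * (p z).re := by
          rw [Complex.inner]
          simp [Complex.normSq_apply]
          ring
        rw [inner_neg_right, h1]
        have := mul_pos (Complex.normSq_pos.2 hz0) (hp z hzd)
        linarith
      have hslope := (hasDerivWithinAt_iff_tendsto_slope' (by simp)).1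
        (hn.hasDerivWithinAt (s := Ioi x))
      have himage : ∀ᶠ s in 𝓝[>] x, γ s ∈ h '' unitDisk := by
        have := image_mem_nhds_of_hasDerivAt isOpen_unitDisk hd hne hzd
        rw [hzx] at this
        exact nhdsWithin_le_nhds (hγc.continuousAt.eventually this)
      obtain ⟨s, ⟨hs1, hs2⟩, hs3⟩ := (((hslope.eventually (gt_mem_nhds hneg)).and himage).and
        (Ioc_mem_nhdsGT hy)).exists
      refine ⟨s, ⟨Function.invFunOn h unitDisk (γ s), ?_, Function.invFunOn_eq hs2⟩, hs3⟩
      have hs4 : 0 < s - x := sub_pos.2 hs3.1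
      rw [slope_def_field, ← hzx, hleft, div_lt_iff₀ hs4, zero_mul, sub_neg] at hs1
      rw [mem_closedBall_zero_iff]
      exact (lt_of_pow_lt_pow_left₀ 2 (norm_nonneg _) hs1).le.trans hz'

/-- For every `p` with positive real part the equation `p(0) h = h' z p` has a spirallike solution
vanishing at the origin. -/
theorem exists_spirallike_zero (hpd : DifferentiableOn ℂ p unitDisk)
    (hp : ∀ z ∈ unitDisk, 0 < (p z).re) :
    ∃ h ∈ Spi 0, (∀ z ∈ unitDisk, deriv h z ≠ 0) ∧
      ∀ z ∈ unitDisk, p 0 * h z = deriv h z * (z * p z) := by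
  have hp0 : ∀ z ∈ unitDisk, p z ≠ 0 := fun z hz h => by
    have := hp z hz
    simp [h] at this
  have h00 := hp0 0 zero_mem_unitDisk
  -- The ansatz `h = z exp k` turns the equation into `k' = (a - 1) / z`, whose singularity is
  -- removable because `a 0 = 1`.
  set a : ℂ → ℂ := fun z => p 0 / p z with ha
  have had : DifferentiableOn ℂ a unitDisk := (differentiableOn_const _).div hpd hp0
  have hds : DifferentiableOn ℂ (dslope a 0) (Metric.ball 0 1) :=
    (Complex.differentiableOn_dslope (isOpen_unitDisk.mem_nhds zero_mem_unitDisk)).2 had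
  obtain ⟨k, hk⟩ := DifferentiableOn.isExactOn_ball hds
  have ha0 : a 0 = 1 := div_self h00
  have hmul : ∀ z, z * dslope a 0 z = a z - 1 := fun z => by
    simpa [ha0] using sub_smul_dslope a 0 z
  set h : ℂ → ℂ := fun z => z * Complex.exp (k z) with hh
  have hder : ∀ z ∈ unitDisk, HasDerivAt h (Complex.exp (k z) * a z) z := fun z hz => by
    refine ((hasDerivAt_id z).mul (hk z hz).cexp).congr_deriv ?_
    simp only [id_eq, one_mul]
    linear_combination Complex.exp (k z) * hmul z
  have hderiv : ∀ z ∈ unitDisk, HasDerivAt h (deriv h z) z := fun z hz =>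
    (hder z hz).differentiableAt.hasDerivAt
  have hne : ∀ z ∈ unitDisk, deriv h z ≠ 0 := fun z hz => by
    rw [(hder z hz).deriv]
    exact mul_ne_zero (Complex.exp_ne_zero _) (div_ne_zero h00 (hp0 z hz))
  have heq : ∀ z ∈ unitDisk, p 0 * h z = deriv h z * (z * p z) := fun z hz => by
    have := hp0 z hz
    rw [(hder z hz).deriv, hh, ha]
    field_simp
  have hexp : ∀ ζ : ℂ, ζ.re < 0 → Complex.exp ζ ∈ unitDisk := fun ζ hζ => by
    rw [mem_unitDisk, Complex.norm_exp]
    exact Real.exp_lt_one_iff.2 hζ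
  -- This is `log h` in the coordinate `ζ = log z`; its derivative `p 0 / p` lies in a rotated
  -- half-plane, so Noshiro–Warschawski applies.
  have hφinj : InjOn (fun ζ => ζ + k (Complex.exp ζ)) {ζ | ζ.re < 0} := by
    refine injOn_of_re_mul_deriv_pos (c := (p 0)⁻¹) (g' := fun ζ => a (Complex.exp ζ))
      (convex_halfSpace_re_lt 0) (fun ζ hζ => ?_) fun ζ hζ => ?_
    · refine ((hasDerivAt_id ζ).add
        ((hk _ (hexp ζ hζ)).comp ζ (Complex.hasDerivAt_exp ζ))).congr_deriv ?_
      linear_combination hmul (Complex.exp ζ)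
    · have : (p 0)⁻¹ * a (Complex.exp ζ) = (p (Complex.exp ζ))⁻¹ := by
        rw [ha]
        field_simp
      rw [this]
      exact re_inv_pos (hp _ (hexp ζ hζ))
  have hinj : InjOn h unitDisk := by
    intro z hz w hw hzw
    have hzero : ∀ z, h z = 0 ↔ z = 0 := fun z => by simp [hh]
    rcases eq_or_ne z 0 with rfl | hz0
    · exact ((hzero w).1 (hzw ▸ (hzero 0).2 rfl)).symm
    · have hw0 : w ≠ 0 := fun h => hz0 ((hzero z).1 (hzw ▸ (hzero w).2 h))
      have hlog : ∀ z ∈ unitDisk, z ≠ 0 → (Complex.log z).re < 0 := fun z hz hz0 => by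
        rw [Complex.log_re]
        exact Real.log_neg (norm_pos_iff.2 hz0) (mem_unitDisk.1 hz)
      have hexpφ : ∀ z, z ≠ 0 → Complex.exp (Complex.log z + k z) = h z := fun z hz0 => by
        rw [Complex.exp_add, Complex.exp_log hz0]
      rw [← hexpφ z hz0, ← hexpφ w hw0, Complex.exp_eq_exp_iff_exists_int] at hzw
      obtain ⟨n, hn⟩ := hzw
      have hper : Complex.exp (Complex.log w + n * (2 * Real.pi * Complex.I)) = w := by
        rw [Complex.exp_add, Complex.exp_log hw0, Complex.exp_int_mul_two_pi_mul_I, mul_one]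
      have := hφinj (x₁ := Complex.log z) (x₂ := Complex.log w + n * (2 * Real.pi * Complex.I))
        (hlog z hz hz0) (by
          change (Complex.log w + n * (2 * Real.pi * Complex.I)).re < 0
          simpa using hlog w hw hw0)
        (by
          simp only
          rw [hper, Complex.exp_log hz0, hn]
          ring)
      rw [← hper, ← this, Complex.exp_log hz0]
  have h0 : h 0 = 0 := by simp [hh]
  refine ⟨h, ⟨⟨⟨fun z hz => (hder z hz).differentiableAt.differentiableWithinAt, hinj⟩, p 0,
    hp 0 zero_mem_unitDisk, fun z hz t ht => ?_⟩, h0⟩, hne, heq⟩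
  exact spiral_mem_image hderiv hinj h0 hne heq hp hz ht

end SpirallikeAtZero

/-! ### Transport of the spirallike functions to an arbitrary zero `τ`. -/

section Moebius

/-- The automorphism of the unit disk that takes `τ` to `0`. -/
noncomputable def diskMoebius (τ z : ℂ) : ℂ := (z - τ) / (1 - conj τ * z)

theorem one_sub_conj_mul_ne_zero {τ z : ℂ} (hτ : ‖τ‖ ≤ 1) (hz : z ∈ unitDisk) :
    1 - conj τ * z ≠ 0 := by
  refine one_sub_ne_zero_of_mem_unitDisk ?_
  rw [mem_unitDisk] at hz ⊢
  rw [norm_mul, Complex.norm_conj]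
  exact (mul_le_of_le_one_left (norm_nonneg _) hτ).trans_lt hz

theorem diskMoebius_mem {τ z : ℂ} (hτ : τ ∈ unitDisk) (hz : z ∈ unitDisk) :
    diskMoebius τ z ∈ unitDisk := by
  have h1 := one_sub_conj_mul_ne_zero (mem_unitDisk.1 hτ).le hz
  rw [mem_unitDisk, diskMoebius, norm_div, div_lt_one (norm_pos_iff.2 h1)]
  refine lt_of_pow_lt_pow_left₀ 2 (norm_nonneg _) ?_
  rw [← Complex.normSq_eq_norm_sq, ← Complex.normSq_eq_norm_sq]
  have h2 := mul_pos (one_sub_normSq_pos hτ) (one_sub_normSq_pos hz)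
  simp only [Complex.normSq_apply, Complex.sub_re, Complex.sub_im, Complex.mul_re, Complex.mul_im,
    Complex.conj_re, Complex.conj_im, Complex.one_re, Complex.one_im] at h2 ⊢
  nlinarith

theorem neg_mem_unitDisk {τ : ℂ} (hτ : τ ∈ unitDisk) : -τ ∈ unitDisk := by
  rw [mem_unitDisk] at hτ ⊢
  rwa [norm_neg]

theorem one_sub_mul_conj_ne_zero {τ : ℂ} (hτ : τ ∈ unitDisk) : 1 - conj τ * τ ≠ 0 :=
  one_sub_conj_mul_ne_zero (mem_unitDisk.1 hτ).le hτ

theorem diskMoebius_neg_diskMoebius {τ z : ℂ} (hτ : τ ∈ unitDisk) (hz : z ∈ unitDisk) :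
    diskMoebius (-τ) (diskMoebius τ z) = z := by
  have h1 := one_sub_conj_mul_ne_zero (mem_unitDisk.1 hτ).le hz
  have h2 := one_sub_conj_mul_ne_zero (mem_unitDisk.1 (neg_mem_unitDisk hτ)).le
    (diskMoebius_mem hτ hz)
  have h3 : diskMoebius τ z * (1 - conj τ * z) = z - τ := div_mul_cancel₀ _ h1
  rw [diskMoebius, div_eq_iff h2, map_neg]
  linear_combination h3

theorem hasDerivAt_diskMoebius {τ z : ℂ} (hτ : τ ∈ unitDisk) (hz : z ∈ unitDisk) :
    HasDerivAt (diskMoebius τ) ((1 - conj τ * τ) / (1 - conj τ * z) ^ 2) z := by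
  have h1 := one_sub_conj_mul_ne_zero (mem_unitDisk.1 hτ).le hz
  refine (((hasDerivAt_id z).sub_const τ).div
    (((hasDerivAt_id z).const_mul (conj τ)).const_sub 1) h1).congr_deriv ?_
  simp only [id_eq]
  ring

theorem diskMoebius_self (τ : ℂ) : diskMoebius τ τ = 0 := by simp [diskMoebius]

theorem diskMoebius_neg_zero (τ : ℂ) : diskMoebius (-τ) 0 = τ := by simp [diskMoebius]

theorem diskMoebius_zero (τ : ℂ) : diskMoebius τ 0 = -τ := by simp [diskMoebius]

/-- For every `p` with positive real part and every point `τ` of the disk, the equation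
`(1 - |τ|²) p(τ) h = h' (z - τ) (1 - τ̄ z) p` has a solution in `Spi τ`. -/
theorem exists_mem_spi {τ : ℂ} (hτ : τ ∈ unitDisk) {p : ℂ → ℂ} (hpd : DifferentiableOn ℂ p unitDisk)
    (hp : ∀ z ∈ unitDisk, 0 < (p z).re) :
    ∃ h ∈ Spi τ, (∀ z ∈ unitDisk, deriv h z ≠ 0) ∧ (τ ≠ 0 → h 0 = 1) ∧
      ∀ z ∈ unitDisk, (1 - conj τ * τ) * p τ * h z =
        deriv h z * ((z - τ) * (1 - conj τ * z) * p z) := by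
  have hτ' := neg_mem_unitDisk hτ
  have hback : ∀ u ∈ unitDisk, diskMoebius τ (diskMoebius (-τ) u) = u := fun u hu => by
    simpa using diskMoebius_neg_diskMoebius hτ' hu
  have hm : MapsTo (diskMoebius τ) unitDisk unitDisk := fun z hz => diskMoebius_mem hτ hz
  have hminj : InjOn (diskMoebius τ) unitDisk := fun z hz w hw h => by
    rw [← diskMoebius_neg_diskMoebius hτ hz, h, diskMoebius_neg_diskMoebius hτ hw]
  obtain ⟨h, ⟨⟨⟨hd, hinj⟩, μ, hμ, hspi⟩, h0⟩, hne, heq⟩ := exists_spirallike_zero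
    (p := fun u => p (diskMoebius (-τ) u))
    (hpd.comp (fun u hu => (hasDerivAt_diskMoebius hτ' hu).differentiableAt.differentiableWithinAt)
      fun u hu => diskMoebius_mem hτ' hu)
    (fun u hu => hp _ (diskMoebius_mem hτ' hu))
  -- The normalization at the origin is impossible for `τ = 0`, where the function vanishes.
  obtain ⟨c, hc0, hc⟩ : ∃ c : ℂ, c ≠ 0 ∧ (τ ≠ 0 → c * h (-τ) = 1) := by
    rcases eq_or_ne τ 0 with rfl | hτ0
    · exact ⟨1, one_ne_zero, fun h => absurd rfl h⟩
    · have : h (-τ) ≠ 0 := fun h' => hτ0 <| neg_eq_zero.1 <|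
        hinj hτ' zero_mem_unitDisk (h'.trans h0.symm)
      exact ⟨(h (-τ))⁻¹, inv_ne_zero this, fun _ => inv_mul_cancel₀ this⟩
  have hder : ∀ z ∈ unitDisk, HasDerivAt (fun z => c * h (diskMoebius τ z))
      (c * (deriv h (diskMoebius τ z) * ((1 - conj τ * τ) / (1 - conj τ * z) ^ 2))) z := by
    intro z hz
    exact ((hd.differentiableAt (isOpen_unitDisk.mem_nhds (hm hz))).hasDerivAt.comp z
      (hasDerivAt_diskMoebius hτ hz)).const_mul c
  refine ⟨fun z => c * h (diskMoebius τ z), ⟨⟨⟨fun z hz =>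
    (hder z hz).differentiableAt.differentiableWithinAt, fun z hz w hw hzw => ?_⟩, μ, hμ,
    fun z hz t ht => ?_⟩, ?_⟩, fun z hz => ?_, fun hτ0 => ?_, fun z hz => ?_⟩
  · exact hminj hz hw (hinj (hm hz) (hm hw) (mul_left_cancel₀ hc0 hzw))
  · obtain ⟨u, hu, hut⟩ := hspi _ (hm hz) t ht
    refine ⟨diskMoebius (-τ) u, diskMoebius_mem hτ' hu, ?_⟩
    simp only
    rw [hback u hu, hut]
    ring
  · simp [diskMoebius_self, h0]
  · rw [(hder z hz).deriv]
    exact mul_ne_zero hc0 (mul_ne_zero (hne _ (hm hz)) (div_ne_zero (one_sub_mul_conj_ne_zero hτ)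
      (pow_ne_zero 2 (one_sub_conj_mul_ne_zero (mem_unitDisk.1 hτ).le hz))))
  · simpa [diskMoebius_zero] using hc hτ0
  · have h1 := heq _ (hm hz)
    simp only [diskMoebius_neg_diskMoebius hτ hz, diskMoebius_neg_zero] at h1
    rw [(hder z hz).deriv]
    have h2 := one_sub_conj_mul_ne_zero (mem_unitDisk.1 hτ).le hz
    calc (1 - conj τ * τ) * p τ * (c * h (diskMoebius τ z))
        = (1 - conj τ * τ) * c * (p τ * h (diskMoebius τ z)) := by ring
      _ = _ := by
        rw [h1, show diskMoebius τ z = (z - τ) / (1 - conj τ * z) from rfl]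
        field_simp

end Moebius

/-! ### Locally uniform convergence and continuous dependence on the coefficient. -/

section LocallyUniform

/-- Locally uniform convergence in the disk to a continuous limit is continuous convergence. -/
theorem tendstoLocallyUniformlyOn_unitDisk_iff {ι : Type*} {l : Filter ι} {H : ι → ℂ → ℂ}
    {g : ℂ → ℂ} (hg : ContinuousOn g unitDisk) :
    TendstoLocallyUniformlyOn H g l unitDisk ↔
      ∀ x ∈ unitDisk, Tendsto (fun y : ι × ℂ => H y.1 y.2) (l ×ˢ 𝓝 x) (𝓝 (g x)) := by
  rw [isOpen_unitDisk.tendstoLocallyUniformlyOn_iff_forall_tendsto]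
  refine forall₂_congr fun x hx => ?_
  have hgx : Tendsto (fun y : ι × ℂ => g y.2) (l ×ˢ 𝓝 x) (𝓝 (g x)) :=
    (hg.continuousAt (isOpen_unitDisk.mem_nhds hx)).tendsto.comp tendsto_snd
  rw [tendsto_uniformity_iff_dist_tendsto_zero]
  constructor <;> intro h
  · exact hgx.congr_dist h
  · simpa using hgx.dist h

/-- A function on a disk with `k 0 = 1` and small logarithmic derivative is close to `1`. -/
theorem norm_sub_one_le_of_hasDerivAt {k e : ℂ → ℂ} {ρ ε : ℝ} (hρ1 : ρ ≤ 1) (hε : 0 < ε)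
    (hk : ∀ z ∈ Metric.closedBall (0 : ℂ) ρ, HasDerivAt k (e z * k z) z) (hk0 : k 0 = 1)
    (he : ∀ z ∈ Metric.closedBall (0 : ℂ) ρ, ‖e z‖ ≤ ε) {z : ℂ}
    (hz : z ∈ Metric.closedBall (0 : ℂ) ρ) : ‖k z - 1‖ ≤ Real.exp ε - 1 := by
  have hz' : ‖z‖ ≤ ρ := mem_closedBall_zero_iff.1 hz
  have hmem : ∀ t ∈ Icc (0 : ℝ) 1, (t : ℂ) * z ∈ Metric.closedBall (0 : ℂ) ρ := fun t ht => by
    rw [mem_closedBall_zero_iff, norm_mul, Complex.norm_real, Real.norm_of_nonneg ht.1]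
    exact (mul_le_of_le_one_left (norm_nonneg _) ht.2).trans hz'
  have hder : ∀ t ∈ Icc (0 : ℝ) 1, HasDerivAt (fun t : ℝ => k (t * z) - 1)
      (e (t * z) * k (t * z) * z) t := fun t ht => by
    have h1 : HasDerivAt (fun t : ℝ => (t : ℂ) * z) z t := by
      simpa using (Complex.ofRealCLM.hasDerivAt (x := t)).mul_const z
    exact ((hk _ (hmem t ht)).comp_of_eq t h1 rfl).sub_const 1
  have := norm_le_gronwallBound_of_norm_deriv_right_le (δ := 0) (K := ε) (ε := ε)
    (fun t ht => (hder t ht).continuousAt.continuousWithinAt)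
    (fun t ht => (hder t (Ico_subset_Icc_self ht)).hasDerivWithinAt) (by simp [hk0])
    (fun t ht => by
      have h1 := he _ (hmem t (Ico_subset_Icc_self ht))
      have h2 : ‖k (t * z)‖ ≤ ‖k (t * z) - 1‖ + 1 := by
        simpa using norm_add_le (k (t * z) - 1) 1
      rw [norm_mul, norm_mul]
      calc ‖e (t * z)‖ * ‖k (t * z)‖ * ‖z‖ ≤ ε * (‖k (t * z) - 1‖ + 1) * 1 := by
            gcongr
            exact hz'.trans hρ1
        _ = _ := by ring) 1 (right_mem_Icc.2 zero_le_one)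
  rw [gronwallBound_of_K_ne_0 hε.ne'] at this
  simpa [hε.ne'] using this

/-- Normalized solutions of the linear equations `h' = a h` depend continuously on `a`. -/
theorem tendstoLocallyUniformlyOn_exp_of_hasDerivAt {ι : Type*} {l : Filter ι} {H a : ι → ℂ → ℂ}
    {E A : ℂ → ℂ} (hE : ∀ z ∈ unitDisk, HasDerivAt E (A z) z) (hE0 : E 0 = 0)
    (ha : TendstoLocallyUniformlyOn a A l unitDisk) (hH0 : ∀ᶠ τ in l, H τ 0 = 1)
    (hH : ∀ ρ < 1, ∀ᶠ τ in l, ∀ z ∈ Metric.closedBall (0 : ℂ) ρ,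
      HasDerivAt (H τ) (a τ z * H τ z) z) :
    TendstoLocallyUniformlyOn H (fun z => Complex.exp (E z)) l unitDisk := by
  rw [Metric.tendstoLocallyUniformlyOn_iff]
  intro η hη x hx
  obtain ⟨ρ, hxρ, hρ⟩ := exists_between (mem_unitDisk.1 hx)
  have hsub : Metric.closedBall (0 : ℂ) ρ ⊆ unitDisk := Metric.closedBall_subset_ball hρ
  have hcont : ContinuousOn (fun z => Complex.exp (E z)) (Metric.closedBall 0 ρ) := fun z hz =>
    (hE z (hsub hz)).continuousAt.cexp.continuousWithinAt
  obtain ⟨B, hB⟩ := (isCompact_closedBall (0 : ℂ) ρ).exists_bound_of_continuousOn hcont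
  have hB0 : 0 ≤ B := (norm_nonneg _).trans
    (hB x (mem_closedBall_zero_iff.2 hxρ.le))
  obtain ⟨ε, hε, hεη⟩ : ∃ ε : ℝ, 0 < ε ∧ B * (Real.exp ε - 1) < η := by
    have hc : Continuous fun ε : ℝ => B * (Real.exp ε - 1) := by fun_prop
    have h1 : ∀ᶠ ε : ℝ in 𝓝[>] 0, B * (Real.exp ε - 1) < η := by
      refine nhdsWithin_le_nhds (hc.continuousAt.eventually (gt_mem_nhds ?_))
      simpa using hη
    obtain ⟨ε, h2, h3⟩ := (h1.and self_mem_nhdsWithin).exists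
    exact ⟨ε, h3, h2⟩
  have hunif := (tendstoLocallyUniformlyOn_iff_forall_isCompact isOpen_unitDisk).1 ha _ hsub
    (isCompact_closedBall _ _)
  refine ⟨Metric.closedBall 0 ρ, mem_nhdsWithin_of_mem_nhds
    (mem_of_superset (Metric.isOpen_ball.mem_nhds (mem_ball_zero_iff.2 hxρ))
      Metric.ball_subset_closedBall), ?_⟩
  filter_upwards [Metric.tendstoUniformlyOn_iff.1 hunif ε hε, hH0, hH ρ hρ] with τ h1 h2 h3 z hz
  -- The quotient `H / exp E` has logarithmic derivative `a - A` and value `1` at the origin.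
  have hk := norm_sub_one_le_of_hasDerivAt (k := fun z => H τ z * Complex.exp (-E z))
    (e := fun z => a τ z - A z) hρ.le hε
    (fun z hz => by
      refine ((h3 z hz).mul (hE z (hsub hz)).neg.cexp).congr_deriv ?_
      simp only [Pi.neg_apply]
      ring) (by simp [h2, hE0])
    (fun z hz => by
      rw [← dist_eq_norm, dist_comm]
      exact (h1 z hz).le) hz
  have hfac : H τ z - Complex.exp (E z) =
      Complex.exp (E z) * (H τ z * Complex.exp (-E z) - 1) := by
    rw [Complex.exp_neg]
    field_simp [Complex.exp_ne_zero]
  rw [dist_comm, dist_eq_norm, hfac, norm_mul]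
  refine lt_of_le_of_lt ?_ hεη
  gcongr
  exact hB z hz

end LocallyUniform

/-! ### Approximation of `exp (μ G)` by functions with a zero at `τ`. -/

section Approximation

variable {f G : ℂ → ℂ} {β : ℝ}

/-- The part of `halfPlaneField f / 2` that remains after removal of the Poisson kernel of the
boundary point `1`. -/
noncomputable def residualField (f : ℂ → ℂ) (β : ℝ) (z : ℂ) : ℂ :=
  (halfPlaneField f z - β * cayley z) / 2

theorem IsGPlusOne.differentiableOn_residualField (hf : IsGPlusOne f β) :
    DifferentiableOn ℂ (residualField f β) unitDisk := by
  refine DifferentiableOn.div_const (DifferentiableOn.sub ?_ (DifferentiableOn.const_mul ?_ _)) _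
  · refine DifferentiableOn.div (hf.differentiableOn.const_mul 2).neg (by fun_prop) fun z hz => ?_
    exact pow_ne_zero 2 (one_sub_ne_zero_of_mem_unitDisk hz)
  · exact fun z hz => (hasDerivAt_cayley hz).differentiableAt.differentiableWithinAt

theorem IsGPlusOne.residualField_re_nonneg (hf : IsGPlusOne f β) {z : ℂ} (hz : z ∈ unitDisk) :
    0 ≤ (residualField f β z).re := by
  have := hf.julia hz
  have h2 : (residualField f β z).re = ((halfPlaneField f z).re - β * (cayley z).re) / 2 := by
    rw [residualField, Complex.div_ofNat_re, Complex.sub_re, Complex.re_ofReal_mul]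
  rw [h2]
  linarith

/-- The Berkson–Porta form of `f` for the boundary point `1`, with the part carrying the angular
derivative split off. -/
theorem eq_residualField (f : ℂ → ℂ) (β : ℝ) {z : ℂ} (hz : z ∈ unitDisk) :
    f z = (z - 1) * (1 - z) * (residualField f β z + β / 2 * cayley z) := by
  have h1 := one_sub_ne_zero_of_mem_unitDisk hz
  rw [residualField, halfPlaneField]
  field_simp
  ring

/-- Borel–Carathéodory for `-q`, whose real part is at most `0`; the bound `1` is used because a
positive one is required. -/
theorem exists_norm_le_div_one_sub {q : ℂ → ℂ} (hqd : DifferentiableOn ℂ q unitDisk)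
    (hq : ∀ z ∈ unitDisk, 0 ≤ (q z).re) :
    ∃ C, 0 ≤ C ∧ ∀ z ∈ unitDisk, ‖q z‖ ≤ C / (1 - ‖z‖) := by
  refine ⟨2 + 2 * ‖q 0‖, by positivity, fun z hz => ?_⟩
  have h := Complex.borelCaratheodory (f := fun z => -q z) one_pos hqd.neg
    (fun z hz => by
      have := hq z hz
      change (-q z).re ≤ 1
      rw [Complex.neg_re]
      linarith) one_pos hz
  rw [norm_neg, norm_neg, ← add_div] at h
  have hz' := mem_unitDisk.1 hz
  refine h.trans ?_
  have : 0 < 1 - ‖z‖ := by linarith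
  refine div_le_div_of_nonneg_right ?_ this.le
  nlinarith [norm_nonneg (q 0)]

/-- The defect `√(1 - |τ|²)` of a point of the disk. -/
noncomputable def diskDefect (τ : ℂ) : ℝ := √(1 - ‖τ‖ ^ 2)

theorem diskDefect_pos {τ : ℂ} (hτ : τ ∈ unitDisk) : 0 < diskDefect τ := by
  have := one_sub_normSq_pos hτ
  rw [Complex.normSq_eq_norm_sq] at this
  exact Real.sqrt_pos.2 this

theorem diskDefect_le_one (τ : ℂ) : diskDefect τ ≤ 1 := by
  refine Real.sqrt_le_one.2 ?_
  nlinarith [norm_nonneg τ]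

theorem sq_diskDefect {τ : ℂ} (hτ : τ ∈ unitDisk) : diskDefect τ ^ 2 = 1 - ‖τ‖ ^ 2 := by
  have := one_sub_normSq_pos hτ
  rw [Complex.normSq_eq_norm_sq] at this
  exact Real.sq_sqrt this.le

theorem ofReal_sq_diskDefect {τ : ℂ} (hτ : τ ∈ unitDisk) :
    (diskDefect τ : ℂ) ^ 2 = 1 - conj τ * τ := by
  rw [← Complex.ofReal_pow, sq_diskDefect hτ, mul_comm, Complex.mul_conj,
    Complex.normSq_eq_norm_sq]
  push_cast
  ring

theorem tendsto_diskDefect : Tendsto diskDefect (𝓝[unitDisk] 1) (𝓝 0) := by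
  have h : Continuous diskDefect := by
    unfold diskDefect
    fun_prop
  have := (h.tendsto 1).mono_left (nhdsWithin_le_nhds (s := unitDisk))
  simpa [diskDefect] using this

/-- The coefficient `c` of the pole shift; it tends to `β / μ`. -/
noncomputable def shiftCoeff (β : ℝ) (μ τ : ℂ) : ℂ :=
  β / μ + ((diskDefect τ ^ 2 * (‖β / μ‖ ^ 2 + 1) : ℝ) : ℂ)

/-- The point `s` with `s τ = 1 - (1 - |τ|²) c`. -/
noncomputable def shiftPoint (β : ℝ) (μ τ : ℂ) : ℂ :=
  (1 - (diskDefect τ : ℂ) ^ 2 * shiftCoeff β μ τ) / τ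

theorem tendsto_shiftCoeff (β : ℝ) (μ : ℂ) :
    Tendsto (shiftCoeff β μ) (𝓝[unitDisk] 1) (𝓝 (β / μ)) := by
  have h1 : Tendsto (fun τ => ((diskDefect τ ^ 2 * (‖(β : ℂ) / μ‖ ^ 2 + 1) : ℝ) : ℂ))
      (𝓝[unitDisk] 1) (𝓝 ((0 ^ 2 * (‖(β : ℂ) / μ‖ ^ 2 + 1) : ℝ) : ℂ)) :=
    (Complex.continuous_ofReal.tendsto _).comp ((tendsto_diskDefect.pow 2).mul_const _)
  have h2 := h1.const_add ((β : ℂ) / μ)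
  rwa [zero_pow two_ne_zero, zero_mul, Complex.ofReal_zero, add_zero] at h2

theorem tendsto_ofReal_diskDefect :
    Tendsto (fun τ => (diskDefect τ : ℂ)) (𝓝[unitDisk] 1) (𝓝 0) := by
  exact (Complex.continuous_ofReal.tendsto' 0 0 Complex.ofReal_zero).comp tendsto_diskDefect

theorem tendsto_shiftPoint (β : ℝ) (μ : ℂ) :
    Tendsto (shiftPoint β μ) (𝓝[unitDisk] 1) (𝓝 1) := by
  have h : Tendsto (shiftPoint β μ) (𝓝[unitDisk] 1) (𝓝 ((1 - 0 ^ 2 * (β / μ)) / 1)) :=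
    (tendsto_const_nhds.sub ((tendsto_ofReal_diskDefect.pow 2).mul (tendsto_shiftCoeff β μ))).div
      (tendsto_id.mono_left nhdsWithin_le_nhds) one_ne_zero
  simpa using h

theorem re_div_of_mem_omegaPlus (hβ : 0 < β) {μ : ℂ} (hμ : μ ∈ OmegaPlus β) :
    1 / 2 ≤ ((β : ℂ) / μ).re := by
  rw [mem_omegaPlus_iff hβ] at hμ
  have hn : 0 < Complex.normSq μ := Complex.normSq_pos.2 hμ.2
  rw [Complex.div_re]
  simp only [Complex.ofReal_re, Complex.ofReal_im, zero_mul, zero_div, add_zero]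
  rw [div_le_div_iff₀ two_pos hn]
  linarith [hμ.1]

/-- With `D = 1 - |τ|²` the claim is `|1 - D c|² ≤ 1 - D`, which follows from `1 + D |c|² ≤ 2 Re c`.
The main part `β / μ` of `c` contributes `2 Re (β / μ) ≥ 1`, and the correction of order `D` pays
for `D |c|²`, so boundary points of `Ω₊` are covered too. -/
theorem norm_shiftPoint_le_one (hβ : 0 < β) {μ τ : ℂ} (hμ : μ ∈ OmegaPlus β) (hτ : τ ∈ unitDisk)
    (hτ0 : τ ≠ 0) (hc : ‖shiftCoeff β μ τ‖ ^ 2 ≤ 2 * (‖(β : ℂ) / μ‖ ^ 2 + 1)) :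
    ‖shiftPoint β μ τ‖ ≤ 1 := by
  rw [shiftPoint, norm_div, div_le_one (norm_pos_iff.2 hτ0)]
  refine le_of_sq_le_sq ?_ (norm_nonneg _)
  have h1 := re_div_of_mem_omegaPlus hβ hμ
  have hre : (shiftCoeff β μ τ).re =
      ((β : ℂ) / μ).re + diskDefect τ ^ 2 * (‖(β : ℂ) / μ‖ ^ 2 + 1) := by
    rw [shiftCoeff, Complex.add_re, Complex.ofReal_re]
  set c := shiftCoeff β μ τ
  set D := diskDefect τ ^ 2 with hD
  have hD' : ‖τ‖ ^ 2 = 1 - D := by rw [hD, sq_diskDefect hτ]; ring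
  have hDn : 0 ≤ D := sq_nonneg _
  have hnorm : ‖1 - (diskDefect τ : ℂ) ^ 2 * c‖ ^ 2 = 1 - 2 * D * c.re + D ^ 2 * ‖c‖ ^ 2 := by
    rw [← Complex.ofReal_pow, ← hD, ← Complex.normSq_eq_norm_sq, ← Complex.normSq_eq_norm_sq]
    simp [Complex.normSq_apply]
    ring
  rw [hnorm, hD']
  have h2 : D * ‖c‖ ^ 2 ≤ 2 * c.re - 1 := by
    have := mul_le_mul_of_nonneg_left hc hDn
    rw [hre]
    linarith
  nlinarith [mul_le_mul_of_nonneg_left h2 hDn]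

/-- The approximating functions with positive real part. -/
noncomputable def approxField (f : ℂ → ℂ) (β : ℝ) (μ τ z : ℂ) : ℂ :=
  residualField f β ((1 - diskDefect τ : ℝ) * z) + β / 2 * cayley (shiftPoint β μ τ * z)

theorem ofReal_mul_mem_unitDisk {r : ℝ} (h0 : 0 ≤ r) (h1 : r ≤ 1) {z : ℂ} (hz : z ∈ unitDisk) :
    (r : ℂ) * z ∈ unitDisk := by
  rw [mem_unitDisk] at hz ⊢
  rw [norm_mul, Complex.norm_real, Real.norm_of_nonneg h0]
  exact (mul_le_of_le_one_left (norm_nonneg _) h1).trans_lt hz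

theorem mul_mem_unitDisk {s z : ℂ} (hs : ‖s‖ ≤ 1) (hz : z ∈ unitDisk) : s * z ∈ unitDisk := by
  rw [mem_unitDisk] at hz ⊢
  rw [norm_mul]
  exact (mul_le_of_le_one_left (norm_nonneg _) hs).trans_lt hz

theorem one_sub_diskDefect_mul_mem {τ z : ℂ} (hτ : τ ∈ unitDisk) (hz : z ∈ unitDisk) :
    ((1 - diskDefect τ : ℝ) : ℂ) * z ∈ unitDisk :=
  ofReal_mul_mem_unitDisk (by linarith [diskDefect_le_one τ]) (by linarith [diskDefect_pos hτ]) hz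

theorem IsGPlusOne.differentiableOn_approxField (hf : IsGPlusOne f β) {μ τ : ℂ}
    (hτ : τ ∈ unitDisk) (hs : ‖shiftPoint β μ τ‖ ≤ 1) :
    DifferentiableOn ℂ (approxField f β μ τ) unitDisk := by
  refine DifferentiableOn.add ?_ (DifferentiableOn.const_mul ?_ _)
  · exact hf.differentiableOn_residualField.comp (by fun_prop)
      fun z hz => one_sub_diskDefect_mul_mem hτ hz
  · exact DifferentiableOn.comp (t := unitDisk)
      (fun z hz => (hasDerivAt_cayley hz).differentiableAt.differentiableWithinAt)
      (by fun_prop) fun z hz => mul_mem_unitDisk hs hz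

theorem IsGPlusOne.approxField_re_pos (hf : IsGPlusOne f β) {μ τ : ℂ} (hτ : τ ∈ unitDisk)
    (hs : ‖shiftPoint β μ τ‖ ≤ 1) {z : ℂ} (hz : z ∈ unitDisk) :
    0 < (approxField f β μ τ z).re := by
  have h1 := hf.residualField_re_nonneg (one_sub_diskDefect_mul_mem hτ hz)
  have h2 : 0 < (cayley (shiftPoint β μ τ * z)).re := cayley_mem (mul_mem_unitDisk hs hz)
  have h3 : ((β : ℂ) / 2 * cayley (shiftPoint β μ τ * z)).re =
      β / 2 * (cayley (shiftPoint β μ τ * z)).re := by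
    rw [show (β : ℂ) / 2 = ((β / 2 : ℝ) : ℂ) by push_cast; rfl, Complex.re_ofReal_mul]
  rw [approxField, Complex.add_re, h3]
  have := mul_pos (half_pos hf.pos) h2
  linarith

theorem IsGPlusOne.tendsto_approxField (hf : IsGPlusOne f β) (μ : ℂ) {x : ℂ} (hx : x ∈ unitDisk) :
    Tendsto (fun y : ℂ × ℂ => approxField f β μ y.1 y.2) (𝓝[unitDisk] 1 ×ˢ 𝓝 x)
      (𝓝 (residualField f β x + β / 2 * cayley x)) := by
  have h1 : Tendsto (fun y : ℂ × ℂ => ((1 - diskDefect y.1 : ℝ) : ℂ) * y.2)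
      (𝓝[unitDisk] 1 ×ˢ 𝓝 x) (𝓝 x) := by
    have : Tendsto (fun y : ℂ × ℂ => (1 - (diskDefect y.1 : ℂ)) * y.2)
        (𝓝[unitDisk] 1 ×ˢ 𝓝 x) (𝓝 ((1 - 0) * x)) :=
      (tendsto_const_nhds.sub (tendsto_ofReal_diskDefect.comp tendsto_fst)).mul tendsto_snd
    simpa using this
  have h2 : Tendsto (fun y : ℂ × ℂ => shiftPoint β μ y.1 * y.2)
      (𝓝[unitDisk] 1 ×ˢ 𝓝 x) (𝓝 x) := by
    simpa using ((tendsto_shiftPoint β μ).comp tendsto_fst).mul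
      (tendsto_snd (f := 𝓝[unitDisk] (1 : ℂ)) (g := 𝓝 x))
  have h3 : ContinuousAt (residualField f β) x :=
    (hf.differentiableOn_residualField.differentiableAt (isOpen_unitDisk.mem_nhds hx)).continuousAt
  exact (h3.tendsto.comp h1).add
    (((hasDerivAt_cayley hx).continuousAt.tendsto.comp h2).const_mul _)

/-- Write `D = √(1 - |τ|²)`. Evaluating the residual part at `(1 - D) τ` bounds it by `C / D`, so
the factor `D²` kills it. Since `s τ = 1 - D² c`, the Cayley part contributes `(β / 2)(2 - D² c) /
c`, which tends to `β / (β / μ) = μ`. -/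
theorem IsGPlusOne.tendsto_approxField_self (hf : IsGPlusOne f β) {μ : ℂ} (hμ : μ ≠ 0) :
    Tendsto (fun τ => (1 - conj τ * τ) * approxField f β μ τ τ) (𝓝[unitDisk] 1) (𝓝 μ) := by
  have hβ0 : (β : ℂ) ≠ 0 := by exact_mod_cast hf.pos.ne'
  have hc0 : (β : ℂ) / μ ≠ 0 := div_ne_zero hβ0 hμ
  have hmem : ∀ᶠ τ in 𝓝[unitDisk] (1 : ℂ), τ ∈ unitDisk := self_mem_nhdsWithin
  have hne0 : ∀ᶠ τ in 𝓝[unitDisk] (1 : ℂ), τ ≠ 0 :=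
    nhdsWithin_le_nhds (isOpen_ne.mem_nhds one_ne_zero)
  obtain ⟨C, hC0, hC⟩ := exists_norm_le_div_one_sub hf.differentiableOn_residualField
    fun z hz => hf.residualField_re_nonneg hz
  have h1 : Tendsto (fun τ => (diskDefect τ : ℂ) ^ 2 *
      residualField f β ((1 - diskDefect τ : ℝ) * τ)) (𝓝[unitDisk] 1) (𝓝 0) := by
    have hlim : Tendsto (fun τ => diskDefect τ * C) (𝓝[unitDisk] 1) (𝓝 0) := by
      simpa using tendsto_diskDefect.mul_const C
    refine squeeze_zero_norm' ?_ hlim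
    filter_upwards [hmem] with τ hτ
    have hD := diskDefect_pos hτ
    have hr0 : 0 ≤ 1 - diskDefect τ := by linarith [diskDefect_le_one τ]
    have hb := hC _ (one_sub_diskDefect_mul_mem hτ hτ)
    rw [norm_mul, Complex.norm_real, Real.norm_of_nonneg hr0] at hb
    have hle : (1 - diskDefect τ) * ‖τ‖ ≤ 1 - diskDefect τ :=
      mul_le_of_le_one_right hr0 (mem_unitDisk.1 hτ).le
    rw [norm_mul, norm_pow, Complex.norm_real, Real.norm_of_nonneg hD.le]
    calc diskDefect τ ^ 2 * ‖residualField f β ((1 - diskDefect τ : ℝ) * τ)‖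
        ≤ diskDefect τ ^ 2 * (C / diskDefect τ) := by
          gcongr
          refine hb.trans ?_
          gcongr
          linarith
      _ = diskDefect τ * C := by field_simp
  have h2 : Tendsto (fun τ => (β : ℂ) / 2 * ((2 - (diskDefect τ : ℂ) ^ 2 * shiftCoeff β μ τ) /
      shiftCoeff β μ τ)) (𝓝[unitDisk] 1) (𝓝 (β / 2 * ((2 - 0 ^ 2 * (β / μ)) / (β / μ)))) :=
    ((tendsto_const_nhds.sub ((tendsto_ofReal_diskDefect.pow 2).mul
      (tendsto_shiftCoeff β μ))).div (tendsto_shiftCoeff β μ) hc0).const_mul _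
  have h3 := h1.add h2
  have e : (0 : ℂ) + β / 2 * ((2 - 0 ^ 2 * (β / μ)) / (β / μ)) = μ := by
    field_simp
    ring
  rw [e] at h3
  refine h3.congr' ?_
  filter_upwards [hmem, hne0, (tendsto_shiftCoeff β μ).eventually (isOpen_ne.mem_nhds hc0)]
    with τ hτ hτ0 hcτ
  have hD : (diskDefect τ : ℂ) ≠ 0 := by exact_mod_cast (diskDefect_pos hτ).ne'
  have hsτ : shiftPoint β μ τ * τ = 1 - (diskDefect τ : ℂ) ^ 2 * shiftCoeff β μ τ :=
    div_mul_cancel₀ _ hτ0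
  rw [← ofReal_sq_diskDefect hτ, approxField, hsτ, cayley, mul_add]
  congr 1
  have hcτ' : shiftCoeff β μ τ ≠ 0 := hcτ
  rw [sub_sub_cancel]
  field_simp
  ring

/-- The approximation theorem: for `μ ∈ Ω₊` the function `exp (μ G)` is the limit of functions
of the classes `Spi τ` as `τ → 1`. -/
theorem IsGPlusOne.exists_spi_tendsto (hf : IsGPlusOne f β)
    (hG : ∀ z ∈ unitDisk, HasDerivAt G (f z)⁻¹ z) (hG0 : G 0 = 0) {μ : ℂ} (hμ : μ ∈ OmegaPlus β) :
    ∃ H : ℂ → ℂ → ℂ, (∀ τ ∈ unitDisk, H τ ∈ Spi τ ∧ ∀ z ∈ unitDisk, deriv (H τ) z ≠ 0) ∧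
      ConvergesAsTauToOne H (fun z => Complex.exp (μ * G z)) := by
  have hex : ∀ τ : ℂ, ∃ h : ℂ → ℂ, τ ∈ unitDisk → h ∈ Spi τ ∧ (∀ z ∈ unitDisk, deriv h z ≠ 0) ∧
      (τ ≠ 0 → h 0 = 1) ∧ (‖shiftPoint β μ τ‖ ≤ 1 → ∀ z ∈ unitDisk,
        (1 - conj τ * τ) * approxField f β μ τ τ * h z =
          deriv h z * ((z - τ) * (1 - conj τ * z) * approxField f β μ τ z)) := by
    intro τ
    by_cases hτ : τ ∈ unitDisk
    · by_cases hs : ‖shiftPoint β μ τ‖ ≤ 1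
      · obtain ⟨h, h1, h2, h3, h4⟩ := exists_mem_spi hτ (hf.differentiableOn_approxField hτ hs)
          fun z hz => hf.approxField_re_pos hτ hs hz
        exact ⟨h, fun _ => ⟨h1, h2, h3, fun _ => h4⟩⟩
      -- An arbitrary member of `Spi τ`: only `τ` near `1` matter for the limit, and there the shift
      -- condition holds.
      · obtain ⟨h, h1, h2, h3, -⟩ := exists_mem_spi hτ (p := fun _ => 1)
          (differentiableOn_const _) fun z hz => by simp
        exact ⟨h, fun _ => ⟨h1, h2, h3, fun h => absurd h hs⟩⟩
    · exact ⟨0, fun h => absurd h hτ⟩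
  choose H hH using hex
  refine ⟨H, fun τ hτ => ⟨(hH τ hτ).1, (hH τ hτ).2.1⟩, ?_⟩
  have hmem : ∀ᶠ τ in 𝓝[unitDisk] (1 : ℂ), τ ∈ unitDisk := self_mem_nhdsWithin
  have hne0 : ∀ᶠ τ in 𝓝[unitDisk] (1 : ℂ), τ ≠ 0 :=
    nhdsWithin_le_nhds (isOpen_ne.mem_nhds one_ne_zero)
  have hs : ∀ᶠ τ in 𝓝[unitDisk] (1 : ℂ), ‖shiftPoint β μ τ‖ ≤ 1 := by
    have hlt : ‖(β : ℂ) / μ‖ ^ 2 < 2 * (‖(β : ℂ) / μ‖ ^ 2 + 1) := by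
      nlinarith [sq_nonneg ‖(β : ℂ) / μ‖]
    filter_upwards [hmem, hne0,
      ((tendsto_shiftCoeff β μ).norm.pow 2).eventually (gt_mem_nhds hlt)] with τ h1 h2 h3
    exact norm_shiftPoint_le_one hf.pos hμ h1 h2 h3.le
  have hcf : ContinuousOn (fun z => μ * (f z)⁻¹) unitDisk :=
    continuousOn_const.mul (hf.differentiableOn.continuousOn.inv₀ fun z hz => hf.ne_zero hz)
  refine tendstoLocallyUniformlyOn_exp_of_hasDerivAt
    -- The logarithmic derivative `f_τ'(τ) / f_τ` of the approximant.
    (a := fun τ z => (1 - conj τ * τ) * approxField f β μ τ τ *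
      ((z - τ) * (1 - conj τ * z) * approxField f β μ τ z)⁻¹)
    (A := fun z => μ * (f z)⁻¹)
    (fun z hz => (hG z hz).const_mul μ) (by simp [hG0]) ?_ ?_ ?_
  · refine (tendstoLocallyUniformlyOn_unitDisk_iff hcf).2 fun x hx => ?_
    refine ((hf.tendsto_approxField_self hμ.2).comp tendsto_fst).mul (Tendsto.inv₀ ?_
      (hf.ne_zero hx))
    rw [eq_residualField f β hx]
    refine Tendsto.mul ?_ (hf.tendsto_approxField μ hx)
    have hid : Tendsto (fun y : ℂ × ℂ => y.1) (𝓝[unitDisk] 1 ×ˢ 𝓝 x) (𝓝 1) :=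
      tendsto_fst.mono_right nhdsWithin_le_nhds
    have hsnd : Tendsto (fun y : ℂ × ℂ => y.2) (𝓝[unitDisk] 1 ×ˢ 𝓝 x) (𝓝 x) := tendsto_snd
    have hconj : Tendsto (fun y : ℂ × ℂ => conj y.1) (𝓝[unitDisk] 1 ×ˢ 𝓝 x) (𝓝 1) := by
      exact (Complex.continuous_conj.tendsto' 1 1 (map_one _)).comp hid
    simpa using (hsnd.sub hid).mul (tendsto_const_nhds.sub (hconj.mul hsnd))
  · filter_upwards [hmem, hne0] with τ h1 h2
    exact (hH τ h1).2.2.1 h2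
  · intro ρ hρ
    -- The logarithmic derivative is singular at `τ`, which therefore has to lie outside the closed
    -- disk.
    have hfar : ∀ᶠ τ in 𝓝[unitDisk] (1 : ℂ), ρ < ‖τ‖ :=
      nhdsWithin_le_nhds (continuous_norm.continuousAt.eventually (lt_mem_nhds (by simpa using hρ)))
    filter_upwards [hmem, hs, hfar] with τ h1 h2 h3 z hz
    obtain ⟨⟨⟨⟨hd, -⟩, -⟩, -⟩, -, -, heq⟩ := hH τ h1
    have hzd : z ∈ unitDisk := Metric.closedBall_subset_ball hρ hz
    have hzτ : z - τ ≠ 0 := by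
      intro h
      rw [sub_eq_zero] at h
      rw [h, mem_closedBall_zero_iff] at hz
      linarith
    have hp : approxField f β μ τ z ≠ 0 := fun h => by
      have := hf.approxField_re_pos h1 h2 hzd
      simp [h] at this
    have hq := one_sub_conj_mul_ne_zero (mem_unitDisk.1 h1).le hzd
    refine (hd.differentiableAt (isOpen_unitDisk.mem_nhds hzd)).hasDerivAt.congr_deriv ?_
    rw [mul_right_comm, heq h2 z hzd]
    exact (mul_inv_cancel_right₀ (mul_ne_zero (mul_ne_zero hzτ hq) hp) _).symm

/-- The reciprocal of a univalent function that vanishes at `τ` has a unique pole, at `τ`,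
which is simple. -/
theorem hasUniqueSimplePoleAt_inv {h : ℂ → ℂ} {τ : ℂ} (hτ : τ ∈ unitDisk) (hh : IsUnivalent h)
    (h0 : h τ = 0) (hne : deriv h τ ≠ 0) : HasUniqueSimplePoleAt (fun z => (h z)⁻¹) τ := by
  have han : AnalyticOnNhd ℂ h unitDisk := hh.1.analyticOnNhd isOpen_unitDisk
  have hmer : MeromorphicOn (fun z => (h z)⁻¹) unitDisk := fun z hz =>
    (han z hz).meromorphicAt.inv
  refine ⟨hmer, DifferentiableOn.inv (hh.1.mono sdiff_subset) fun z hz hz0 => ?_, ?_⟩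
  · exact hz.2 (hh.2 hz.1 hτ (hz0.trans h0.symm))
  · have hds : DifferentiableOn ℂ (dslope h τ) unitDisk :=
      (Complex.differentiableOn_dslope (isOpen_unitDisk.mem_nhds hτ)).2 hh.1
    have hds0 : dslope h τ τ ≠ 0 := by rwa [dslope_same]
    refine (meromorphicOrderAt_eq_int_iff (n := -1) (hmer τ hτ)).2
      -- As `h τ = 0`, `h = (z - τ) * dslope h τ`, and the second factor equals `deriv h τ ≠ 0` at
      -- `τ`.
      ⟨fun z => (dslope h τ z)⁻¹, (hds.analyticAt (isOpen_unitDisk.mem_nhds hτ)).inv hds0,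
        inv_ne_zero hds0, Eventually.of_forall fun z => ?_⟩
    have := sub_smul_dslope h τ z
    rw [h0, sub_zero] at this
    rw [← this, smul_eq_mul, smul_eq_mul, mul_inv, zpow_neg_one]

theorem ConvergesAsTauToOne.inv {H : ℂ → ℂ → ℂ} {g : ℂ → ℂ} (hH : ConvergesAsTauToOne H g)
    (hg : ContinuousOn g unitDisk) (h0 : ∀ z ∈ unitDisk, g z ≠ 0) :
    ConvergesAsTauToOne (fun τ z => (H τ z)⁻¹) (fun z => (g z)⁻¹) :=
  (tendstoLocallyUniformlyOn_unitDisk_iff (hg.inv₀ h0)).2 fun x hx =>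
    ((tendstoLocallyUniformlyOn_unitDisk_iff hg).1 hH x hx).inv₀ (h0 x hx)

end Approximation

/-! ### Solutions of the initial value problem as exponentials of `G`. -/

section Solutions

variable {f G h : ℂ → ℂ} {β : ℝ} {lam : ℂ}

theorem IsGPlusOne.isSolution_exp (hf : IsGPlusOne f β)
    (hG : ∀ z ∈ unitDisk, HasDerivAt G (f z)⁻¹ z) (hG0 : G 0 = 0) (lam : ℂ) :
    IsSolution f lam (fun z => Complex.exp (lam * G z)) := by
  have hder : ∀ z ∈ unitDisk, HasDerivAt (fun z => Complex.exp (lam * G z))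
      (Complex.exp (lam * G z) * (lam * (f z)⁻¹)) z := fun z hz => ((hG z hz).const_mul lam).cexp
  refine ⟨fun z hz => (hder z hz).differentiableAt.differentiableWithinAt, fun z hz => ?_,
    by simp [hG0]⟩
  have := hf.ne_zero hz
  rw [(hder z hz).deriv]
  field_simp

/-- The product `h * exp (-lam * G)` has zero derivative on the connected disk and equals `1` at the
origin. -/
theorem IsSolution.eq_exp (hh : IsSolution f lam h) (hf : IsGPlusOne f β)
    (hG : ∀ z ∈ unitDisk, HasDerivAt G (f z)⁻¹ z) (hG0 : G 0 = 0) {z : ℂ} (hz : z ∈ unitDisk) :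
    h z = Complex.exp (lam * G z) := by
  have hder : ∀ z ∈ unitDisk, HasDerivAt (fun z => h z * Complex.exp (-(lam * G z))) 0 z := by
    intro z hz
    have h1 := (hh.holomorphic.differentiableAt (isOpen_unitDisk.mem_nhds hz)).hasDerivAt
    refine (h1.mul ((hG z hz).const_mul lam).neg.cexp).congr_deriv ?_
    have h2 := hh.equation z hz
    have h3 := hf.ne_zero hz
    simp only [Pi.neg_apply]
    field_simp
    linear_combination -Complex.exp (-(lam * G z)) * h2
  have hconst := isOpen_unitDisk.is_const_of_deriv_eq_zero (convex_ball 0 1).isPreconnected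
    (fun z hz => (hder z hz).differentiableAt.differentiableWithinAt)
    (fun z hz => (hder z hz).deriv) hz zero_mem_unitDisk
  simp only [hh.initial, hG0, mul_zero, neg_zero, Complex.exp_zero, mul_one] at hconst
  rwa [Complex.exp_neg, mul_inv_eq_one₀ (Complex.exp_ne_zero _)] at hconst

theorem IsSolution.isHolPower (hh : IsSolution f lam h) (hf : IsGPlusOne f β)
    (hG : ∀ z ∈ unitDisk, HasDerivAt G (f z)⁻¹ z) (hG0 : G 0 = 0) (hlam : lam ≠ 0) (μ : ℂ) :
    IsHolPower h (μ / lam) (fun z => Complex.exp (μ * G z)) := by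
  refine ⟨fun z => lam * G z,
    fun z hz => ((hG z hz).const_mul lam).differentiableAt.differentiableWithinAt, by simp [hG0],
    fun z hz => (hh.eq_exp hf hG hG0 hz).symm, fun z _ => ?_⟩
  field_simp

theorem IsGPlusOne.exists_univalent_solution_iff (hf : IsGPlusOne f β)
    (hG : ∀ z ∈ unitDisk, HasDerivAt G (f z)⁻¹ z) (hG0 : G 0 = 0) (lam : ℂ) :
    (∃ h : ℂ → ℂ, IsSolution f lam h ∧ IsUnivalent h) ↔ lam ∈ OmegaPlus β ∪ OmegaMinus β := by
  rcases eq_or_ne lam 0 with rfl | hlam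
  -- For `lam = 0` the solution is the constant `1`, which is not injective.
  · refine iff_of_false ?_ ?_
    · rintro ⟨h, hh, -, hinj⟩
      have hhalf : (1 / 2 : ℂ) ∈ unitDisk := by
        rw [mem_unitDisk]
        norm_num
      have := hinj hhalf zero_mem_unitDisk (by
        rw [hh.eq_exp hf hG hG0 hhalf, hh.eq_exp hf hG hG0 zero_mem_unitDisk, zero_mul, zero_mul])
      norm_num at this
    · rintro (h | h) <;> exact h.2 rfl
  · rw [mem_omega_union_iff hf.pos hlam, ← hf.injOn_exp_iff hG hlam]
    constructor
    · rintro ⟨h, hh, -, hinj⟩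
      exact hinj.congr fun z hz => hh.eq_exp hf hG hG0 hz
    · intro hinj
      have hs := hf.isSolution_exp hG hG0 lam
      exact ⟨_, hs, hs.holomorphic, hinj⟩

end Solutions

theorem theorem3p4 (f : ℂ → ℂ) (β : ℝ) (hf : IsGPlusOne f β) :
    (∀ lam : ℂ, (∃ h : ℂ → ℂ, IsSolution f lam h ∧ IsUnivalent h) ↔
      lam ∈ OmegaPlus β ∪ OmegaMinus β) ∧
    ∀ lam : ℂ, lam ≠ 0 → ∀ h : ℂ → ℂ, IsSolution f lam h →
      (∀ μ ∈ OmegaPlus β, ∃ h₁ : ℂ → ℂ, IsHolPower h (μ / lam) h₁ ∧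
        ∃ H : ℂ → ℂ → ℂ, (∀ τ ∈ unitDisk, H τ ∈ Spi τ) ∧ ConvergesAsTauToOne H h₁) ∧
      (lam ∈ OmegaPlus β →
        ∃ H : ℂ → ℂ → ℂ, (∀ τ ∈ unitDisk, H τ ∈ Spi τ) ∧ ConvergesAsTauToOne H h) ∧
      (∀ μ ∈ OmegaMinus β, ∃ h₂ : ℂ → ℂ, IsHolPower h (μ / lam) h₂ ∧
        ∃ H : ℂ → ℂ → ℂ, (∀ τ ∈ unitDisk, HasUniqueSimplePoleAt (H τ) τ) ∧
          ConvergesAsTauToOne H h₂) := by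
  obtain ⟨G, hG0, hG⟩ := hf.exists_primitive
  refine ⟨hf.exists_univalent_solution_iff hG hG0, fun lam hlam h hh => ⟨fun μ hμ => ?_,
    fun hmem => ?_, fun μ hμ => ?_⟩⟩
  · obtain ⟨H, hH, hconv⟩ := hf.exists_spi_tendsto hG hG0 hμ
    exact ⟨_, hh.isHolPower hf hG hG0 hlam μ, H, fun τ hτ => (hH τ hτ).1, hconv⟩
  · obtain ⟨H, hH, hconv⟩ := hf.exists_spi_tendsto hG hG0 hmem
    exact ⟨H, fun τ hτ => (hH τ hτ).1,
      hconv.congr_right fun z hz => (hh.eq_exp hf hG hG0 hz).symm⟩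
  -- The approximants of `exp (-μ G)` have simple zeros at `τ`; their reciprocals have simple poles
  -- there and tend to `exp (μ G)`, since the limit is zero-free.
  · obtain ⟨H, hH, hconv⟩ := hf.exists_spi_tendsto hG hG0 (neg_mem_omegaPlus.2 hμ)
    refine ⟨_, hh.isHolPower hf hG hG0 hlam μ, fun τ z => (H τ z)⁻¹, fun τ hτ =>
      hasUniqueSimplePoleAt_inv hτ (hH τ hτ).1.1.1 (hH τ hτ).1.2 ((hH τ hτ).2 τ hτ), ?_⟩
    have hc : ContinuousOn (fun z => Complex.exp (-μ * G z)) unitDisk := fun z hz =>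
      ((hG z hz).const_mul (-μ)).cexp.continuousAt.continuousWithinAt
    have := hconv.inv hc fun z _ => Complex.exp_ne_zero _
    simpa only [neg_mul, Complex.exp_neg, inv_inv] using this
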